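/- Fix $\chi\in\mathbb{C}$. For $m\ge 0$, an $m$-diagram is a non-crossing pairing, by strands drawn in a strip, of $2m$ points, $m$ on the left line and $m$ on the right line. The Temperley--Lieb algebra $\mathrm{TL}_m$ with loop value $\chi$ is the complex vector space with the $m$-diagrams as basis; the product is concatenation, each closed loop being replaced by a factor $\chi$. The diagrammatic trace $\mathrm{Tr}_{\mathrm{TL}_m}$ is the linear functional that sends a diagram to $\chi^{\#\text{loops}}$, where the loops are those obtained by joining each left point to the opposite right point. Let $m$ be even and $0\le k\le m/2$. An $(m,k)$-link state consists of $m$ points on a line, $2k$ of which (the defects) carry an open strand going off to the right, while the other points are joined in pairs by arcs, with no crossings among arcs and open strands. The standard module $\mathcal V^{(m)}_k$ is the complex vector space with the $(m,k)$-link states as basis; a diagram acts on a link state by concatenation (the link state on the right), each closed loop being replaced by a factor $\chi$, and the result being $0$ if two defects become connected to each other. Let $\pi^{(m)}_k(t)$ denote the matrix of $t\in\mathrm{TL}_m$ on $\mathcal V^{(m)}_k$. For $q\in\mathbb{C}\setminus\{0\}$ and $n\ge 0$ put $[n]_q=q^{n-1}+q^{n-3}+\cdots+q^{-(n-1)}$,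 which equals $\dfrac{q^n-q^{-n}}{q-q^{-1}}$ if $q\ne q^{-1}$. **Proposition.** There are numbers $d_k=d_k(\chi)\in\mathbb{C}$, $k=0,1,2,\dots$, not depending on $m$, such that for every even $m$ $$\mathrm{Tr}_{\mathrm{TL}_m}(t)=\sum_{k=0}^{m/2} d_k\,\mathrm{tr}\bigl(\pi^{(m)}_k(t)\bigr)\qquad\text{for all } t\in\mathrm{TL}_m .$$ If $\chi\neq 0$, these multiplicities are unique: if $m$ is even and $c_0,\dots,c_{m/2}\in\mathbb{C}$ satisfy $\mathrm{Tr}_{\mathrm{TL}_m}(t)=\sum_{k} c_k\,\mathrm{tr}(\pi^{(m)}_k(t))$ for all $t\in\mathrm{TL}_m$, then $c_k=d_k$ for all $k\le m/2$. Moreover, for every $q\ne 0$ with $\chi=q+q^{-1}$, $$d_k=[2k+1]_q\qquad (k\ge 0),$$ and $d_k=P_k(\chi)$, where $P_k$ is a polynomial with integer coefficients that does not depend on $\chi$, given by $$P_k(X)=\frac1{4^k}\sum_{n=1}^{k+1}\binom{2k+1}{2n-1}X^{2(k-n+1)}(X^2-4)^{n-1};$$ in particular $P_0=1$, $P_1=X^2-1$,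 $P_2=X^4-3X^2+1$, $P_3=X^6-5X^4+6X^2-1$. -/

import Mathlib

namespace TemperleyLieb

/-- The `2 * m` marked points of an `m`-diagram: `Sum.inl i` is the `i`-th point of the left line
and `Sum.inr i` is the `i`-th point of the right line (both numbered from top to bottom). -/
abbrev Pt (m : ℕ) : Type := Fin m ⊕ Fin m

/-- The place of a marked point when one walks around the boundary of the strip: down the left
line, then up the right line. -/
def pos {m : ℕ} : Pt m → ℕ
  | Sum.inl i => i
  | Sum.inr i => 2 * m - 1 - i

/-- An `m`-diagram: the `2 * m` marked points are joined in pairs (`join p` is the other end of the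
strand at `p`) by strands that can be drawn in the strip without crossings. -/
structure Diagram (m : ℕ) where
  join : Pt m → Pt m
  join_join : ∀ p, join (join p) = p
  join_ne : ∀ p, join p ≠ p
  noncrossing : ∀ p q, ¬ (pos p < pos q ∧ pos q < pos (join p) ∧ pos (join p) < pos (join q))

/-- An `(m, k)`-link state: `m` points on a line; `join i` is the other end of the arc at `i`, and
`join i = i` means that there is a defect (an open strand leading off to the right) at `i`.
The arcs do not cross each other or the defects, and there are `2 * k` defects. (This is the
labelling of link states for even `m`.) -/
structure LinkState (m k : ℕ) where
  join : Fin m → Fin m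
  join_join : ∀ i, join (join i) = i
  noncrossing : ∀ i j, ¬ (i < j ∧ j < join i ∧ join i < join j)
  defect_free : ∀ i j, join j = j → ¬ (i < j ∧ j < join i)
  card_defects : Nat.card {i : Fin m // join i = i} = 2 * k

theorem Diagram.join_injective (m : ℕ) :
    Function.Injective (Diagram.join : Diagram m → Pt m → Pt m) := by
  rintro ⟨f, _, _, _⟩ ⟨g, _, _, _⟩ h
  cases h
  rfl

theorem LinkState.join_injective (m k : ℕ) :
    Function.Injective (LinkState.join : LinkState m k → Fin m → Fin m) := by
  rintro ⟨f, _, _, _, _⟩ ⟨g, _, _, _, _⟩ h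
  cases h
  rfl

noncomputable instance (m : ℕ) : Fintype (Diagram m) :=
  Fintype.ofInjective _ (Diagram.join_injective m)

noncomputable instance (m k : ℕ) : Fintype (LinkState m k) :=
  Fintype.ofInjective _ (LinkState.join_injective m k)

/-! ### The algebra

Whenever pictures are glued, the relation below says that two points are directly joined by a
strand or identified by the gluing. Its quotient `Quot` is the set of connected components of the
glued picture. -/

/-- The underlying vector space of the Temperley-Lieb algebra: formal complex linear combinations
of `m`-diagrams. -/
abbrev TL (m : ℕ) : Type := Diagram m →₀ ℂ

/-- Concatenation of `a` (on the left, points `Sum.inl _`) and `b` (on the right, points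
`Sum.inr _`). -/
def mulRel {m : ℕ} (a b : Diagram m) (x y : Pt m ⊕ Pt m) : Prop :=
  (∃ p, x = Sum.inl p ∧ y = Sum.inl (a.join p)) ∨
  (∃ p, x = Sum.inr p ∧ y = Sum.inr (b.join p)) ∨
  (∃ i, x = Sum.inl (Sum.inr i) ∧ y = Sum.inr (Sum.inl i))

/-- The points on the outer boundary lines of a concatenation of two diagrams. -/
def outer {m : ℕ} : Pt m → Pt m ⊕ Pt m
  | Sum.inl i => Sum.inl (Sum.inl i)
  | Sum.inr i => Sum.inr (Sum.inr i)

/-- `c` is the diagram obtained from the concatenation of `a` and `b` by erasing closed loops. -/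
def IsProduct {m : ℕ} (a b c : Diagram m) : Prop :=
  ∀ p q, p ≠ q →
    (c.join p = q ↔ Quot.mk (mulRel a b) (outer p) = Quot.mk (mulRel a b) (outer q))

/-- The number of closed loops in the concatenation of `a` and `b`. -/
noncomputable def mulLoops {m : ℕ} (a b : Diagram m) : ℕ :=
  Nat.card {C : Quot (mulRel a b) // ∀ p, Quot.mk (mulRel a b) (outer p) ≠ C}

open Classical in
/-- The product of the Temperley-Lieb algebra with loop value `χ`: concatenate diagrams, replace
each closed loop by a factor `χ`, and extend bilinearly. -/
noncomputable def mul (χ : ℂ) (m : ℕ) : TL m →ₗ[ℂ] TL m →ₗ[ℂ] TL m :=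
  Finsupp.linearCombination ℂ fun a => Finsupp.linearCombination ℂ fun b =>
    ∑ c : Diagram m, if IsProduct a b c then Finsupp.single c (χ ^ mulLoops a b) else 0

/-! ### The diagrammatic trace -/

/-- Closing up a diagram: each left point is joined to the right point opposite to it. -/
def closeRel {m : ℕ} (a : Diagram m) (p q : Pt m) : Prop :=
  q = a.join p ∨ q = p.swap

/-- The number of closed loops of the closed-up diagram. -/
noncomputable def closeLoops {m : ℕ} (a : Diagram m) : ℕ := Nat.card (Quot (closeRel a))

/-- The diagrammatic trace: `χ ^ #loops` of the closed-up diagram, extended linearly. -/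
noncomputable def trTL (χ : ℂ) (m : ℕ) : TL m →ₗ[ℂ] ℂ :=
  Finsupp.linearCombination ℂ fun a => χ ^ closeLoops a

/-! ### The standard modules -/

/-- Concatenation of a diagram `a` (on the left) with a link state `v` (on the right); the points
of `v` are identified with the right points of `a`. -/
def actRel {m k : ℕ} (a : Diagram m) (v : LinkState m k) (p q : Pt m) : Prop :=
  q = a.join p ∨ ∃ i, p = Sum.inr i ∧ q = Sum.inr (v.join i)

/-- Concatenating `a` and `v` gives the link state `w` after erasing closed loops: no two defects
of `v` become connected with each other (no disconnected strand), and two distinct left points are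
joined by an arc of `w` if and only if they are connected in the concatenation. -/
def ActsTo {m k : ℕ} (a : Diagram m) (v w : LinkState m k) : Prop :=
  (∀ i j, v.join i = i → v.join j = j →
    Quot.mk (actRel a v) (Sum.inr i) = Quot.mk (actRel a v) (Sum.inr j) → i = j) ∧
  (∀ i j, i ≠ j →
    (w.join i = j ↔ Quot.mk (actRel a v) (Sum.inl i) = Quot.mk (actRel a v) (Sum.inl j)))

/-- The number of closed loops in the concatenation of `a` and `v`: components that contain neither
a left point nor a defect of `v`. -/
noncomputable def actLoops {m k : ℕ} (a : Diagram m) (v : LinkState m k) : ℕ :=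
  Nat.card {C : Quot (actRel a v) //
    (∀ i, Quot.mk (actRel a v) (Sum.inl i) ≠ C) ∧
    (∀ i, v.join i = i → Quot.mk (actRel a v) (Sum.inr i) ≠ C)}

open Classical in
/-- The matrix of the action of a diagram on the standard module, in the basis of `(m, k)`-link
states: the link state `v` is sent to `χ ^ #loops` times the link state obtained by concatenation,
or to `0` if the concatenation has fewer defects. -/
noncomputable def actMatrix (χ : ℂ) {m : ℕ} (k : ℕ) (a : Diagram m) :
    Matrix (LinkState m k) (LinkState m k) ℂ :=
  Matrix.of fun w v => if ActsTo a v w then χ ^ actLoops a v else 0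

/-- The matrix representation of the Temperley-Lieb algebra on the standard module spanned by
`(m, k)`-link states. -/
noncomputable def stdRep (χ : ℂ) (m k : ℕ) :
    TL m →ₗ[ℂ] Matrix (LinkState m k) (LinkState m k) ℂ :=
  Finsupp.linearCombination ℂ fun a => actMatrix χ k a

/-- `d` is a system of module multiplicities for `m`: the diagrammatic trace is the sum of the
traces over the standard modules `k = 0, …, m / 2`, weighted with the numbers `d k`. -/
def IsMultiplicity (χ : ℂ) (m : ℕ) (d : Fin (m / 2 + 1) → ℂ) : Prop :=
  ∀ t : TL m, trTL χ m t = ∑ k, d k * (stdRep χ m k t).trace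

/-- The `q`-number `[n]_q = q ^ (n - 1) + q ^ (n - 3) + ⋯ + q ^ (-(n - 1))`. -/
noncomputable def qNumber (q : ℂ) (n : ℕ) : ℂ :=
  ∑ j ∈ Finset.range n, q ^ ((n : ℤ) - 1 - 2 * (j : ℤ))

end TemperleyLieb

/-!
The diagrammatic trace and the traces over the standard modules are cyclic, and this determines
them by their values at the units.

Suppose that a diagram `a` joins the neighbouring right points `i` and `j`. If it also joins the
left points `i` and `j`, then removing these two strands takes away one closed loop from each
concatenation and from the closure (`IsInsertion.trace_actMatrix`, `IsInsertion.closeLoops_eq`).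
Otherwise let `E` be the operator on link states that connects the strands at `i` and `j` with
each other and adds an arc from `i` to `j` (`spliceMatrix`). Then `π(a) E = χ π(a)` and `E π(a) =
π(b)`, where `b` arises from `a` by the same operation at the left points, so `tr π(b) = χ tr
π(a)` (`trace_actMatrix_splice`); also the closure of `b` has one loop more than that of `a`
(`closeLoops_splice`). As `b` has both strands, two points can be removed. A diagram in which no
right points are joined is the unit (`eq_one_of_no_cap`). So for `χ ≠ 0` the trace identity
reduces to the units, where it says that `∑ k, d k * #(link states with 2 k defects) = χ ^ m`.
This holds for quantum integers `d k = [2 k + 1]`, because a link state can be extended to one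
more point by a defect or by closing its last defect, and `χ [l + 1] = [l + 2] + [l]`
(`sum_numFixed`). The case `χ = 0` follows by continuity.

In `E π(a)` the concatenation of a diagram and a link state has to be a link state again
(`exists_actsTo`). Its components are orbits of two involutions, and they are loops or paths with
two end points (`exists_other_end`). That they do not cross follows from counting modulo `2`, for
two different components, the pairs of points of which the first comes earlier
(`sum_before_left`).

Insertion of arcs multiplies all traces by `χ`. So for `χ ≠ 0` the multiplicities for `m` points
determine those for `m + 2` points except the last, which the unit determines
(`multiplicity_unique`).
-/

namespace TemperleyLieb

/-! ### Orbits of two involutions -/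

/-- The orbits of two maps `f` and `g` on `X`: the components of the graph joining each `p` to `f p`
and to `g p`. -/
abbrev Orb {X : Type} (f g : X → X) : Type := Quot fun p q : X => q = f p ∨ q = g p

/-- The orbit of a point. -/
abbrev orb {X : Type} (f g : X → X) (p : X) : Orb f g :=
  Quot.mk (fun p q : X => q = f p ∨ q = g p) p

theorem orb_left {X : Type} (f g : X → X) (p : X) : orb f g (f p) = orb f g p :=
  (Quot.sound (r := fun p q : X => q = f p ∨ q = g p) (Or.inl rfl)).symm

theorem orb_right {X : Type} (f g : X → X) (p : X) : orb f g (g p) = orb f g p :=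
  (Quot.sound (r := fun p q : X => q = f p ∨ q = g p) (Or.inr rfl)).symm

/-- An invariant function is constant on orbits. -/
theorem eq_of_orb_eq {X Y : Type} {f g : X → X} (Φ : X → Y) (hf : ∀ p, Φ (f p) = Φ p)
    (hg : ∀ p, Φ (g p) = Φ p) {p q : X} (h : orb f g p = orb f g q) : Φ p = Φ q :=
  congrArg (Quot.lift Φ (by rintro a b (rfl | rfl) <;> simp [hf, hg])) h

/-- If `f` and `g` are involutions and `f` has no fixed point, then an orbit that contains one fixed
point of `g` contains exactly one other: the orbit is a path from the one to the other. -/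
theorem exists_other_end {X : Type} [Finite X] {f g : X → X} (hf : Function.Involutive f)
    (hg : Function.Involutive g) (hne : ∀ p, f p ≠ p) {x : X} (hx : g x = x) :
    ∃ y, y ≠ x ∧ g y = y ∧ orb f g y = orb f g x ∧
      ∀ z, g z = z → orb f g z = orb f g x → z = x ∨ z = y := by
  -- With `ρ = f * g` the orbit of `x` is `{ρ ^ n x}`, on which `g` acts by `n ↦ -n` and `f` by
  -- `n ↦ 1 - n`.
  set F : Equiv.Perm X := hf.toPerm with hF
  set G : Equiv.Perm X := hg.toPerm with hG
  have hFF : F⁻¹ = F := by ext p; rw [Equiv.Perm.inv_eq_iff_eq]; exact (hf p).symm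
  have hGG : G⁻¹ = G := by ext p; rw [Equiv.Perm.inv_eq_iff_eq]; exact (hg p).symm
  set ρ : Equiv.Perm X := F * G with hρ
  have hGρ : ∀ n : ℤ, G * ρ ^ n = ρ ^ (-n) * G := by
    intro n
    have h1 : G * ρ * G⁻¹ = ρ⁻¹ := by
      rw [hρ, mul_inv_rev, hFF, hGG, ← mul_assoc, mul_assoc _ G G]
      nth_rewrite 3 [← hGG]
      simp
    rw [zpow_neg, ← inv_zpow, ← h1, conj_zpow]; group
  have hFρ : ∀ n : ℤ, F * ρ ^ n = ρ ^ (-n) * F := by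
    intro n
    have h1 : F * ρ * F⁻¹ = ρ⁻¹ := by
      rw [hρ, mul_inv_rev, hFF, hGG, ← mul_assoc]; nth_rewrite 1 [← hFF]; simp
    rw [zpow_neg, ← inv_zpow, ← h1, conj_zpow]; group
  have gn : ∀ n : ℤ, g ((ρ ^ n) x) = (ρ ^ (-n)) x := by
    intro n
    have := congrArg (fun e : Equiv.Perm X => e x) (hGρ n)
    simpa [hG, hx] using this
  have fn : ∀ n : ℤ, f ((ρ ^ n) x) = (ρ ^ (1 - n)) x := by
    intro n
    have h1 := congrArg (fun e : Equiv.Perm X => e x) (hFρ n)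
    have h2 : f x = ρ x := by simp [hρ, hF, hG, hx]
    simp only [Equiv.Perm.mul_apply] at h1
    rw [sub_eq_neg_add, zpow_add, zpow_one, Equiv.Perm.mul_apply, ← h2]
    exact h1
  have key : ∀ n : ℤ, (ρ ^ n) x = x ↔ (Function.minimalPeriod ρ x : ℤ) ∣ n := fun n =>
    MulAction.zpow_smul_eq_iff_minimalPeriod_dvd (a := ρ) (b := x)
  have key2 : ∀ n k : ℤ, (ρ ^ n) x = (ρ ^ k) x ↔ (Function.minimalPeriod ρ x : ℤ) ∣ n - k := by
    intro n k
    rw [← key, sub_eq_neg_add, zpow_add, Equiv.Perm.mul_apply, zpow_neg,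
      Equiv.Perm.inv_eq_iff_eq]
  set N := Function.minimalPeriod ρ x with hN
  have hNpos : 0 < N := Function.IsPeriodicPt.minimalPeriod_pos (n := orderOf ρ) (orderOf_pos ρ)
    (by
      rw [Function.IsPeriodicPt, Function.IsFixedPt, ← Equiv.Perm.coe_pow, pow_orderOf_eq_one]
      rfl)
  obtain ⟨t, ht | ht⟩ := Nat.even_or_odd' N
  swap
  · refine absurd ?_ (hne ((ρ ^ ((t : ℤ) + 1)) x))
    rw [fn, key2, ht]
    exact ⟨-1, by push_cast; ring⟩
  have horb : ∀ n : ℤ, orb f g ((ρ ^ n) x) = orb f g x := by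
    have h1 : ∀ p, orb f g (ρ p) = orb f g p := fun p => by
      rw [hρ, Equiv.Perm.mul_apply]; exact (orb_left f g _).trans (orb_right f g p)
    intro n
    induction n with
    | zero => simp
    | succ n ih => rw [add_comm, zpow_add, zpow_one, Equiv.Perm.mul_apply, h1, ih]
    | pred n ih =>
      rw [← ih, ← h1 ((ρ ^ (-(n : ℤ) - 1)) x), ← Equiv.Perm.mul_apply, ← zpow_one_add]
      congr 3; ring
  have hmem : ∀ z, orb f g z = orb f g x → ∃ n : ℤ, z = (ρ ^ n) x := by
    intro z hz
    have h := eq_of_orb_eq (f := f) (g := g) (fun z => ∃ n : ℤ, z = (ρ ^ n) x) ?_ ?_ hz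
    · rw [h]; exact ⟨0, by simp⟩
    · intro p
      refine propext ⟨?_, ?_⟩ <;> rintro ⟨n, hn⟩
      · exact ⟨1 - n, by rw [← fn, ← hn, hf]⟩
      · exact ⟨1 - n, by rw [hn, fn]⟩
    · intro p
      refine propext ⟨?_, ?_⟩ <;> rintro ⟨n, hn⟩
      · exact ⟨-n, by rw [← gn, ← hn, hg]⟩
      · exact ⟨-n, by rw [hn, gn]⟩
  refine ⟨(ρ ^ (t : ℤ)) x, ?_, ?_, horb _, ?_⟩
  · rw [Ne, key, ht]
    intro h
    have := Int.le_of_dvd (by omega) h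
    push_cast at this
    omega
  · rw [gn, key2, ht]
    exact ⟨-1, by push_cast; ring⟩
  · intro z hz hzx
    obtain ⟨n, rfl⟩ := hmem z hzx
    rw [gn, key2, ht] at hz
    obtain ⟨c, hc⟩ := hz
    push_cast at hc
    have hn : n = t * -c := by linarith
    rcases Int.even_or_odd' (-c) with ⟨e, he | he⟩
    · left
      rw [key, ht, hn, he]
      exact ⟨e, by push_cast; ring⟩
    · right
      rw [key2, ht, hn, he]
      exact ⟨e, by push_cast; ring⟩

/-- The number of orbits without a fixed point of `g`: the closed loops. -/
noncomputable def numLoops {X : Type} (f g : X → X) : ℕ :=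
  Nat.card {C : Orb f g // ∀ p, g p = p → orb f g p ≠ C}

/-- The orbits that are not closed loops are paths, with two end points each. -/
theorem two_mul_card_orb {X : Type} [Finite X] {f g : X → X} (hf : Function.Involutive f)
    (hg : Function.Involutive g) (hne : ∀ p, f p ≠ p) :
    2 * Nat.card (Orb f g) = 2 * numLoops f g + Nat.card {p // g p = p} := by
  classical
  have h1 : Nat.card (Orb f g) = numLoops f g +
      Nat.card {C : Orb f g // ¬ ∀ p, g p = p → orb f g p ≠ C} := by
    rw [numLoops, ← Nat.card_sum]
    exact Nat.card_congr (Equiv.sumCompl _).symm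
  have h2 : Nat.card {p // g p = p} =
      2 * Nat.card {C : Orb f g // ¬ ∀ p, g p = p → orb f g p ≠ C} := by
    let φ : {p // g p = p} → {C : Orb f g // ¬ ∀ p, g p = p → orb f g p ≠ C} :=
      fun p => ⟨orb f g p, fun h => h p p.2 rfl⟩
    have := Fintype.ofFinite {C : Orb f g // ¬ ∀ p, g p = p → orb f g p ≠ C}
    rw [← Nat.card_congr (Equiv.sigmaFiberEquiv φ), Nat.card_sigma]
    have : ∀ C, Nat.card {p // φ p = C} = 2 := by
      rintro ⟨C, hC⟩
      push Not at hC
      obtain ⟨x, hx, rfl⟩ := hC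
      obtain ⟨y, hyx, hy, hor, hz⟩ := exists_other_end hf hg hne hx
      refine Nat.card_eq_two_iff.2 ⟨⟨⟨x, hx⟩, rfl⟩, ⟨⟨y, hy⟩, Subtype.ext hor⟩, ?_, ?_⟩
      · simpa using hyx.symm
      · ext ⟨⟨z, hz1⟩, hz2⟩
        simpa using hz z hz1 (congrArg Subtype.val hz2)
    simp only [this, Finset.sum_const, Finset.card_univ, smul_eq_mul, Nat.card_eq_fintype_card,
      mul_comm]
  omega

/-! ### Splices -/

/-- Splicing an involution at `x` and `y`: these two points are joined with each other, and so are
their former partners. If `x` had no partner then the former partner of `y` has none any more, and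
conversely. -/
def splice {X : Type} [DecidableEq X] (f : X → X) (x y p : X) : X :=
  if p = x then y else if p = y then x
  else if f p = x then (if f y = y then p else f y)
  else if f p = y then (if f x = x then p else f x)
  else f p

section Splice

variable {X : Type} [DecidableEq X] {f g : X → X} {x y : X}

theorem splice_left : splice f x y x = y := by simp [splice]

theorem splice_right : splice f x y y = x := by
  by_cases h : y = x <;> simp [splice, h]

theorem splice_involutive (hf : Function.Involutive f) :
    Function.Involutive (splice f x y) := by
  intro p
  have h1 := hf p
  have h2 := hf x
  have h3 := hf y
  unfold splice
  grind

theorem splice_ne (hf : Function.Involutive f) (hxy : x ≠ y) (hne : ∀ p, f p ≠ p) (p : X) :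
    splice f x y p ≠ p := by
  have h1 := hf p
  have h2 := hf x
  have h3 := hf y
  have h4 := hne p
  unfold splice
  grind

/-- Splicing a pair that is joined already changes nothing. -/
theorem splice_eq_self (hf : Function.Involutive f) (h : f x = y) : splice f x y = f := by
  funext p
  have h1 := hf p
  have h2 := hf x
  unfold splice
  grind

/-- Splicing is conjugation by a transposition, so it preserves the number of fixed points. -/
theorem card_fixed_splice (hf : Function.Involutive f) (hxy : x ≠ y)
    (h : ¬ (f x = x ∧ f y = y)) :
    Nat.card {p // splice f x y p = p} = Nat.card {p // f p = p} := by
  have key : ∀ u v : X, (∀ p, splice f x y (Equiv.swap u v p) = Equiv.swap u v (f p)) →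
      Nat.card {p // splice f x y p = p} = Nat.card {p // f p = p} := by
    intro u v huv
    refine (Nat.card_congr ((Equiv.swap u v).subtypeEquiv fun p => ?_)).symm
    rw [huv, (Equiv.swap u v).injective.eq_iff]
  by_cases hy : f y = y
  · refine key (f x) y fun p => ?_
    have h1 := hf p
    have h2 := hf x
    have h3 : f x ≠ x := fun h' => h ⟨h', hy⟩
    simp only [splice, Equiv.swap_apply_def]
    grind
  · refine key (f y) x fun p => ?_
    have h1 := hf p
    have h2 := hf x
    have h3 := hf y
    simp only [splice, Equiv.swap_apply_def]
    grind

end Splice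

/-- The situation in which a splice of `f` cuts off an orbit `T`: a set which contains `x` and `y`,
and which the strands of `f` at `x` and `y` leave (unless `x` or `y` is an end point). -/
structure CutsOff {X : Type} [DecidableEq X] (f g : X → X) (x y : X) (T : Set X) : Prop where
  inv : Function.Involutive f
  inv' : Function.Involutive g
  left_mem : x ∈ T
  right_mem : y ∈ T
  map_mem : ∀ p ∈ T, g p ∈ T
  map_mem' : ∀ p ∈ T, p ≠ x → p ≠ y → f p ∈ T
  left_out : f x = x ∨ f x ∉ T
  right_out : f y = y ∨ f y ∉ T
  not_both : ¬ (f x = x ∧ f y = y)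
  conn : ∀ p ∈ T, orb (splice f x y) g p = orb (splice f x y) g x
  conn' : ∀ p ∈ T, orb f g p = orb f g x ∨ orb f g p = orb f g y

open Classical in
/-- The orbit of a point, after the orbits of `x` and `y` have been merged. -/
noncomputable def mergedOrb {X : Type} (f g : X → X) (x y p : X) : Orb f g :=
  if orb f g p = orb f g x then orb f g y else orb f g p

namespace CutsOff

variable {X : Type} [DecidableEq X] {f g : X → X} {x y : X} {T : Set X}

theorem mergedOrb_map (_ : CutsOff f g x y T) (p : X) :
    mergedOrb f g x y (g p) = mergedOrb f g x y p := by
  have := orb_right f g p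
  unfold mergedOrb
  grind

theorem mergedOrb_splice (_ : CutsOff f g x y T) (p : X) :
    mergedOrb f g x y (splice f x y p) = mergedOrb f g x y p := by
  have hx := orb_left f g x
  have hy := orb_left f g y
  have hp := orb_left f g p
  unfold mergedOrb splice
  grind

/-- A former partner of `x` or of `y`: a point next to `T` on a strand that leads out of `T`. -/
noncomputable def exit (f : X → X) (x y : X) : X := if f x = x then f y else f x

theorem exit_notMem (H : CutsOff f g x y T) : exit f x y ∉ T := by
  have h1 := H.left_out
  have h2 := H.right_out
  have h3 := H.not_both
  unfold exit
  grind

open Classical in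
/-- There is a map from the old orbits to the new ones which sends the points of `T` to the merged
strand. -/
theorem exists_orb_of_orb_eq (H : CutsOff f g x y T) :
    ∃ Φ : X → Orb (splice f x y) g,
      (∀ p ∉ T, Φ p = orb (splice f x y) g p) ∧
      (∀ p ∈ T, Φ p = orb (splice f x y) g (exit f x y)) ∧
      (∀ p q, orb f g p = orb f g q → Φ p = Φ q) := by
  set Φ : X → Orb (splice f x y) g := fun p =>
    if p ∈ T then orb (splice f x y) g (exit f x y) else orb (splice f x y) g p with hΦ
  have hfx : f x ∉ T → f y ∉ T → orb (splice f x y) g (f y) = orb (splice f x y) g (f x) := by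
    intro h1 h2
    rw [← orb_left (splice f x y) g (f x)]
    have hx := H.inv x
    have := H.left_mem
    have := H.right_mem
    have : splice f x y (f x) = f y := by unfold splice; grind
    rw [this]
  have hout : ∀ p ∈ T, f p ∉ T → Φ (f p) = Φ p := by
    intro p hp hfp
    have h3 : p = x ∨ p = y := by
      by_contra h
      push Not at h
      exact hfp (H.map_mem' p hp h.1 h.2)
    simp only [hΦ, hp, hfp, if_true, if_false]
    have := H.left_mem
    rcases h3 with rfl | rfl
    · have : exit f p y = f p := by unfold exit; grind
      rw [this]
    · by_cases h4 : f x = x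
      · simp [exit, h4]
      · simp only [exit, h4, if_false]
        exact hfx (H.left_out.resolve_left h4) hfp
  refine ⟨Φ, fun p hp => by simp [hΦ, hp], fun p hp => by simp [hΦ, hp], fun p q h =>
    eq_of_orb_eq Φ ?_ ?_ h⟩
  · intro p
    by_cases hp : p ∈ T <;> by_cases hfp : f p ∈ T
    · simp [hΦ, hp, hfp]
    · exact hout p hp hfp
    · have := hout (f p) hfp (by rwa [H.inv p])
      rw [H.inv p] at this
      exact this.symm
    · have : splice f x y p = f p := by
        have := H.left_mem
        have := H.right_mem
        unfold splice
        grind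
      simp only [hΦ, hp, hfp, if_false]
      rw [← this, orb_left]
  · intro p
    by_cases hp : p ∈ T
    · simp [hΦ, hp, H.map_mem p hp]
    · have : g p ∉ T := fun h => hp (by simpa [H.inv' p] using H.map_mem _ h)
      simp [hΦ, hp, this, orb_right]

theorem orb_ne (H : CutsOff f g x y T) {p : X} (hp : p ∉ T) :
    orb (splice f x y) g p ≠ orb (splice f x y) g x := by
  intro h
  have hcl : ∀ e : X → X, Function.Involutive e → (∀ p ∈ T, e p ∈ T) →
      ∀ p, (e p ∈ T) = (p ∈ T) := fun e he hT p =>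
    propext ⟨fun h => by simpa [he p] using hT _ h, hT p⟩
  have h1 := eq_of_orb_eq (· ∈ T) (hcl _ (splice_involutive H.inv) ?_)
    (hcl _ H.inv' H.map_mem) h
  · exact hp (h1.mpr H.left_mem)
  · intro q hq
    have h1 := H.left_mem
    have h2 := H.right_mem
    have h3 := H.map_mem' q hq
    have h4 := H.left_out
    have h5 := H.right_out
    have h6 := H.inv q
    unfold splice
    grind

/-- Away from `T`, the splice merges the orbits of `x` and `y` and changes nothing else. -/
theorem orb_eq_iff (H : CutsOff f g x y T) {p q : X} (hp : p ∉ T) (hq : q ∉ T) :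
    orb (splice f x y) g p = orb (splice f x y) g q ↔
      mergedOrb f g x y p = mergedOrb f g x y q := by
  refine ⟨eq_of_orb_eq _ H.mergedOrb_splice H.mergedOrb_map, fun h => ?_⟩
  obtain ⟨Φ, h1, h2, h3⟩ := H.exists_orb_of_orb_eq
  rw [← h1 p hp, ← h1 q hq]
  have h4 : Φ x = Φ y := by rw [h2 x H.left_mem, h2 y H.right_mem]
  unfold mergedOrb at h
  split_ifs at h with h5 h6 h6
  · exact h3 _ _ (h5.trans h6.symm)
  · rw [h3 p x h5, h4, h3 y q h]
  · rw [h3 p y h, ← h4, h3 x q h6.symm]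
  · exact h3 _ _ h

open Classical in
/-- The splice adds the orbit `T`, and merges the orbits of `x` and `y` if they differ. -/
theorem card_orb [Finite X] (H : CutsOff f g x y T) :
    Nat.card (Orb (splice f x y) g) + (if orb f g x = orb f g y then 0 else 1) =
      Nat.card (Orb f g) + 1 := by
  have hsplit : ∀ {Y : Type} [Finite Y] (P : Y → Prop),
      Nat.card Y = Nat.card {c // P c} + Nat.card {c // ¬ P c} := by
    intro Y _ P
    rw [← Nat.card_sum]
    exact Nat.card_congr (Equiv.sumCompl P).symm
  have e1 := hsplit fun C : Orb (splice f x y) g => C = orb (splice f x y) g x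
  have e2 := hsplit fun C : Orb f g => ¬ (orb f g x = orb f g y ∨ C ≠ orb f g x)
  have h1 : Nat.card {C : Orb (splice f x y) g // C = orb (splice f x y) g x} = 1 := by simp
  have h2 : Nat.card {C : Orb f g // ¬ (orb f g x = orb f g y ∨ C ≠ orb f g x)} =
      if orb f g x = orb f g y then 0 else 1 := by
    split_ifs with h <;> simp [h]
  -- Merging maps the new orbits other than `T` bijectively onto the old orbits other than that of
  -- `x`, or onto all old orbits if `x` and `y` lie on one orbit.
  have h3 : Nat.card {C : Orb (splice f x y) g // ¬ C = orb (splice f x y) g x} =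
      Nat.card {C : Orb f g // ¬ ¬ (orb f g x = orb f g y ∨ C ≠ orb f g x)} := by
    set K : Orb (splice f x y) g → Orb f g := Quot.lift (mergedOrb f g x y) (by
      rintro a b (rfl | rfl)
      · exact (H.mergedOrb_splice a).symm
      · exact (H.mergedOrb_map a).symm)
    have hout : ∀ p, orb (splice f x y) g p ≠ orb (splice f x y) g x → p ∉ T :=
      fun p h hp => h (H.conn p hp)
    refine Nat.card_congr (Equiv.ofBijective
      (fun C => ⟨K C.1, ?_⟩) ⟨?_, ?_⟩)
    · rw [not_not]
      obtain ⟨⟨p⟩, hC⟩ := C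
      rw [show K (Quot.mk _ p) = mergedOrb f g x y p from rfl]
      unfold mergedOrb
      grind
    · rintro ⟨⟨p⟩, hp⟩ ⟨⟨q⟩, hq⟩ h
      exact Subtype.ext ((H.orb_eq_iff (hout p hp) (hout q hq)).2 (congrArg Subtype.val h))
    · rintro ⟨⟨p⟩, hp⟩
      rw [not_not] at hp
      replace hp : orb f g x = orb f g y ∨ orb f g p ≠ orb f g x := hp
      by_cases hT : p ∈ T
      · refine ⟨⟨orb _ _ (exit f x y), H.orb_ne H.exit_notMem⟩, Subtype.ext ?_⟩
        change mergedOrb f g x y (exit f x y) = orb f g p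
        have h1 := orb_left f g x
        have h2 := orb_left f g y
        have h3 := H.conn' p hT
        unfold mergedOrb exit
        grind
      · refine ⟨⟨orb _ _ p, H.orb_ne hT⟩, Subtype.ext ?_⟩
        change mergedOrb f g x y p = orb f g p
        unfold mergedOrb
        grind
  omega

end CutsOff

/-! ### Planar involutions -/

/-- `1` if `p` comes before `q` and `0` otherwise, in `ℤ/2`. -/
def before {X : Type} (ps : X → ℕ) (p q : X) : ZMod 2 := if ps p < ps q then 1 else 0

/-- An involution of points placed on a line at the positions `ps`, drawn as arcs and defects, is
planar if the arcs cross neither each other nor the defects. -/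
def IsPlanar {X : Type} (ps : X → ℕ) (h : X → X) : Prop :=
  (∀ p q, ¬ (ps p < ps q ∧ ps q < ps (h p) ∧ ps (h p) < ps (h q))) ∧
  (∀ p q, h q = q → ¬ (ps p < ps q ∧ ps q < ps (h p)))

section Planar

variable {X : Type} {ps : X → ℕ} {h : X → X}

/-- The end points of two strands of a planar involution interleave an even number of times. -/
theorem IsPlanar.arcs (H : IsPlanar ps h) (hps : Function.Injective ps)
    (hh : Function.Involutive h) {p q : X} (h1 : q ≠ p) (h2 : q ≠ h p) :
    before ps p q + before ps (h p) q + before ps p (h q) + before ps (h p) (h q) = 0 := by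
  have e1 := H.1 p q
  have e2 := H.1 (h p) q
  have e3 := H.1 p (h q)
  have e4 := H.1 (h p) (h q)
  have e5 := H.1 q p
  have e6 := H.1 (h q) p
  have e7 := H.1 q (h p)
  have e8 := H.1 (h q) (h p)
  have d1 := H.2 p q
  have d2 := H.2 (h p) q
  have d3 := H.2 q p
  have d4 := H.2 (h q) p
  rw [hh p] at *
  rw [hh q] at *
  have n1 : ps q ≠ ps p := fun e => h1 (hps e)
  have n2 : ps q ≠ ps (h p) := fun e => h2 (hps e)
  have n3 : ps (h q) ≠ ps p := fun e => h2 (by rw [← hps e, hh q])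
  have n4 : ps (h q) ≠ ps (h p) := fun e => h1 (hh.injective (hps e))
  have n5 : ps (h q) = ps q → h q = q := fun e => hps e
  have n6 : ps (h p) = ps p → h p = p := fun e => hps e
  clear h1 h2
  unfold before
  split_ifs <;> first | rfl | (exfalso; omega)

/-- The end points of a strand of a planar involution lie on the same side of each defect. -/
theorem IsPlanar.defect (H : IsPlanar ps h) (hps : Function.Injective ps)
    (hh : Function.Involutive h) {d : X} (hd : h d = d) (p : X) :
    before ps d p + before ps d (h p) = 0 := by
  have e1 := H.2 p d hd
  have e2 := H.2 (h p) d hd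
  rw [hh p] at e2
  have n1 : ps d = ps p → d = p := fun e => hps e
  have n2 : ps d = ps (h p) → d = h p := fun e => hps e
  by_cases hp : p = d
  · subst hp
    simp [before, hd]
  have n3 : d ≠ h p := fun e => hp (by rw [← hh p, ← e, hd])
  unfold before
  split_ifs <;> first | rfl | (exfalso; grind)

theorem isPlanar_of_before
    (h1 : ∀ p q, q ≠ p → q ≠ h p →
      before ps p q + before ps (h p) q + before ps p (h q) + before ps (h p) (h q) = 0)
    (h2 : ∀ d, h d = d → ∀ p, before ps d p + before ps d (h p) = 0) : IsPlanar ps h := by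
  constructor
  · rintro p q ⟨e1, e2, e3⟩
    have := h1 p q (by rintro rfl; omega) (by rintro rfl; omega)
    have f1 : ¬ ps (h p) < ps q := by omega
    have f2 : ps p < ps (h q) := by omega
    simp [before, e1, e3, f1, f2] at this
    exact absurd this (by decide)
  · rintro p q hq ⟨e1, e2⟩
    have := h2 q hq p
    have f1 : ¬ ps q < ps p := by omega
    simp [before, e2, f1] at this

/-- Splicing at neighbouring points preserves planarity. -/
theorem IsPlanar.splice [DecidableEq X] (H : IsPlanar ps h) (hps : Function.Injective ps)
    (hh : Function.Involutive h) {x y : X} (hxy : x ≠ y)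
    (hadj : ∀ q, q ≠ x → q ≠ y → (ps x < ps q ↔ ps y < ps q)) (hnb : ¬ (h x = x ∧ h y = y)) :
    IsPlanar ps (splice h x y) := by
  have two : ∀ z : ZMod 2, z + z = 0 := CharTwo.add_self_eq_zero
  -- No point lies between `x` and `y`. Hence modulo `2` the strand that joins the former partners
  -- of `x` and `y` interleaves with another strand as the two former strands do together.
  have b1 : ∀ q, q ≠ x → q ≠ y → before ps x q = before ps y q := by
    intro q h1 h2
    simp only [before, hadj q h1 h2]
  have b2 : ∀ q, q ≠ x → q ≠ y → before ps q x = before ps q y := by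
    intro q h1 h2
    have n1 : ps q ≠ ps x := fun e => h1 (hps e)
    have n2 : ps q ≠ ps y := fun e => h2 (hps e)
    have := hadj q h1 h2
    have : ps q < ps x ↔ ps q < ps y := by omega
    simp only [before, this]
  have A := fun p q => H.arcs (p := p) (q := q) hps hh
  have D := fun d (hd : h d = d) p => H.defect hps hh hd p
  have hx := hh x
  have hy := hh y
  refine isPlanar_of_before ?_ ?_
  · intro p q hqp hqp'
    have hp := hh p
    have hq := hh q
    have hqp'' : p ≠ TemperleyLieb.splice h x y q := by
      rintro rfl
      exact hqp' (splice_involutive hh q).symm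
    by_cases px : p = x ∨ p = y
    · have q1 : q ≠ x ∧ q ≠ y := by unfold TemperleyLieb.splice at hqp'; grind
      have q2 : TemperleyLieb.splice h x y q ≠ x ∧ TemperleyLieb.splice h x y q ≠ y := by
        unfold TemperleyLieb.splice; grind
      rcases px with rfl | rfl
      · rw [splice_left, b1 q q1.1 q1.2, b1 _ q2.1 q2.2]
        grind
      · rw [splice_right, b1 q q1.1 q1.2, b1 _ q2.1 q2.2]
        grind
    by_cases qx : q = x ∨ q = y
    · have q1 : p ≠ x ∧ p ≠ y := by grind
      have q2 : TemperleyLieb.splice h x y p ≠ x ∧ TemperleyLieb.splice h x y p ≠ y := by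
        unfold TemperleyLieb.splice; grind
      rcases qx with rfl | rfl
      · rw [splice_left, b2 p q1.1 q1.2, b2 _ q2.1 q2.2]
        grind
      · rw [splice_right, b2 p q1.1 q1.2, b2 _ q2.1 q2.2]
        grind
    push Not at px qx
    by_cases hpx : h p = x
    · by_cases hyy : h y = y
      · have : TemperleyLieb.splice h x y p = p := by unfold TemperleyLieb.splice; grind
        rw [this]
        grind
      · have e1 : TemperleyLieb.splice h x y p = h y := by unfold TemperleyLieb.splice; grind
        have e2 : TemperleyLieb.splice h x y q = h q := by unfold TemperleyLieb.splice; grind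
        have := A x q
        have := A y q
        have hqx : h q ≠ x := by grind
        have hqy : h q ≠ y := by grind
        have := b1 q
        have := b1 (h q) hqx hqy
        rw [e1] at hqp' ⊢
        rw [e2]
        grind
    by_cases hpy : h p = y
    · by_cases hxx : h x = x
      · have : TemperleyLieb.splice h x y p = p := by unfold TemperleyLieb.splice; grind
        rw [this]
        grind
      · have e1 : TemperleyLieb.splice h x y p = h x := by unfold TemperleyLieb.splice; grind
        have e2 : TemperleyLieb.splice h x y q = h q := by unfold TemperleyLieb.splice; grind
        have := A x q
        have := A y q
        have hqx : h q ≠ x := by grind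
        have hqy : h q ≠ y := by grind
        have := b1 q
        have := b1 (h q) hqx hqy
        rw [e1] at hqp' ⊢
        rw [e2]
        grind
    have e1 : TemperleyLieb.splice h x y p = h p := by unfold TemperleyLieb.splice; grind
    rw [e1] at hqp' ⊢
    have := A p x
    have := A p y
    have := b2 p
    have := b2 (h p) hpx hpy
    by_cases hqx : h q = x
    · by_cases hyy : h y = y
      · have : TemperleyLieb.splice h x y q = q := by unfold TemperleyLieb.splice; grind
        rw [this]
        grind
      · have e2 : TemperleyLieb.splice h x y q = h y := by unfold TemperleyLieb.splice; grind
        rw [e2]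
        grind
    by_cases hqy : h q = y
    · by_cases hxx : h x = x
      · have : TemperleyLieb.splice h x y q = q := by unfold TemperleyLieb.splice; grind
        rw [this]
        grind
      · have e2 : TemperleyLieb.splice h x y q = h x := by unfold TemperleyLieb.splice; grind
        rw [e2]
        grind
    have e2 : TemperleyLieb.splice h x y q = h q := by unfold TemperleyLieb.splice; grind
    rw [e2]
    exact A p q hqp hqp'
  · intro d hd p
    have dx : d ≠ x := by rintro rfl; rw [splice_left] at hd; exact hxy hd.symm
    have dy : d ≠ y := by rintro rfl; rw [splice_right] at hd; exact hxy hd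
    have hd2 := hh d
    have hp2 := hh p
    by_cases px : p = x
    · subst px; rw [splice_left, b2 d dx dy]; exact two _
    by_cases py : p = y
    · subst py; rw [splice_right, b2 d dx dy]; exact two _
    by_cases hdd : h d = d
    · have := D d hdd x
      have := D d hdd y
      have := D d hdd p
      have := b2 d dx dy
      unfold TemperleyLieb.splice
      grind
    by_cases hpd : p = d
    · subst hpd; rw [hd]; exact two _
    have hd3 : (h d = x ∧ h y = y) ∨ (h d = y ∧ h x = x) := by
      unfold TemperleyLieb.splice at hd; grind
    have := b1 p px py
    have hpx : h p ≠ x := by grind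
    have hpy : h p ≠ y := by grind
    have := b1 (h p) hpx hpy
    have hs : TemperleyLieb.splice h x y p = h p := by unfold TemperleyLieb.splice; grind
    rw [hs]
    rcases hd3 with ⟨h3, h4⟩ | ⟨h3, h4⟩
    · have := D y h4 p
      have := A x p
      grind
    · have := D x h4 p
      have := A y p
      grind

end Planar

/-! ### Composition of a diagram with a link state -/

theorem before_of_lt {X : Type} {ps : X → ℕ} {p q : X} (h : ps p < ps q) : before ps p q = 1 :=
  if_pos h

theorem before_of_not_lt {X : Type} {ps : X → ℕ} {p q : X} (h : ¬ ps p < ps q) :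
    before ps p q = 0 :=
  if_neg h

theorem pos_injective (m : ℕ) : Function.Injective (pos : Pt m → ℕ) := by
  rintro (⟨i, hi⟩ | ⟨i, hi⟩) (⟨j, hj⟩ | ⟨j, hj⟩) h <;> simp only [pos] at h
  · subst h; rfl
  · omega
  · omega
  · have : i = j := by omega
    subst this; rfl

namespace Diagram

theorem isPlanar {m : ℕ} (a : Diagram m) : IsPlanar pos a.join :=
  ⟨a.noncrossing, fun _ q hq => absurd hq (a.join_ne q)⟩

end Diagram

namespace LinkState

variable {m k : ℕ}

theorem isPlanar (v : LinkState m k) : IsPlanar (fun i : Fin m => (i : ℕ)) v.join :=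
  ⟨v.noncrossing, fun i j => v.defect_free i j⟩

/-- The strands of a link state on the right points of a diagram, the left points being loose
ends. -/
def ext (v : LinkState m k) : Pt m → Pt m := Sum.map id v.join

theorem ext_involutive (v : LinkState m k) : Function.Involutive v.ext := by
  rintro (i | i) <;> simp [ext, v.join_join]

@[simp] theorem ext_inl (v : LinkState m k) (i : Fin m) : v.ext (Sum.inl i) = Sum.inl i := rfl

@[simp] theorem ext_inr (v : LinkState m k) (i : Fin m) :
    v.ext (Sum.inr i) = Sum.inr (v.join i) := rfl

theorem ext_inr_eq_iff (v : LinkState m k) (i : Fin m) :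
    v.ext (Sum.inr i) = Sum.inr i ↔ v.join i = i := by simp

end LinkState

section Act

variable {m k : ℕ} (a : Diagram m) (v w : LinkState m k)

theorem actRel_iff_orb {p q : Pt m} :
    Quot.mk (actRel a v) p = Quot.mk (actRel a v) q ↔
      orb a.join v.ext p = orb a.join v.ext q := by
  constructor
  · intro h
    refine congrArg (Quot.lift (orb a.join v.ext) ?_) h
    rintro p q (rfl | ⟨i, rfl, rfl⟩)
    · exact (orb_left _ _ p).symm
    · exact (orb_right a.join v.ext (Sum.inr i)).symm
  · intro h
    refine eq_of_orb_eq (Quot.mk (actRel a v)) ?_ ?_ h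
    · exact fun p => (Quot.sound (r := actRel a v) (Or.inl rfl)).symm
    · rintro (i | i)
      · rfl
      · exact (Quot.sound (r := actRel a v) (Or.inr ⟨i, rfl, rfl⟩)).symm

theorem actsTo_iff : ActsTo a v w ↔
    (∀ i j, v.join i = i → v.join j = j →
      orb a.join v.ext (Sum.inr i) = orb a.join v.ext (Sum.inr j) → i = j) ∧
    (∀ i j, i ≠ j →
      (w.join i = j ↔ orb a.join v.ext (Sum.inl i) = orb a.join v.ext (Sum.inl j))) := by
  simp only [ActsTo, actRel_iff_orb]

theorem actLoops_eq : actLoops a v = numLoops a.join v.ext := by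
  let e : Quot (actRel a v) ≃ Orb a.join v.ext :=
    { toFun := Quot.lift (orb a.join v.ext) fun p q h =>
        (actRel_iff_orb a v).1 (Quot.sound h)
      invFun := Quot.lift (Quot.mk (actRel a v)) fun p q h =>
        (actRel_iff_orb a v).2 (Quot.sound (r := fun p q => q = a.join p ∨ q = v.ext p) h)
      left_inv := by rintro ⟨p⟩; rfl
      right_inv := by rintro ⟨p⟩; rfl }
  refine Nat.card_congr (e.subtypeEquiv fun C => ?_)
  have he : ∀ p, e (Quot.mk _ p) = orb a.join v.ext p := fun p => rfl
  constructor
  · rintro ⟨h1, h2⟩ (i | i) hi hC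
    · exact h1 i (e.injective hC)
    · exact h2 i (by simpa using hi) (e.injective hC)
  · intro h
    refine ⟨fun i hi => h (Sum.inl i) rfl ?_, fun i hv hi => h (Sum.inr i) (by simpa) ?_⟩
    · rw [← hi]; rfl
    · rw [← hi]; rfl

variable {a v}

/-- A diagram takes a link state to at most one link state. -/
theorem ActsTo.unique {w w' : LinkState m k} (h : ActsTo a v w) (h' : ActsTo a v w') : w = w' := by
  apply LinkState.join_injective
  funext i
  by_contra hne
  by_cases h1 : w.join i = i
  · have h2 : i ≠ w'.join i := fun e => hne (h1.trans e)
    exact hne ((h.2 i _ h2).2 ((h'.2 i _ h2).1 rfl))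
  · exact hne ((h'.2 i _ (Ne.symm h1)).2 ((h.2 i _ (Ne.symm h1)).1 rfl)).symm

/-- Two invariant weights with disjoint supports, the second one vanishing on the defects, live on
strands that do not cross. -/
theorem IsPlanar.sum_eq_zero {X : Type} [Fintype X] {ps : X → ℕ} {h : X → X} (H : IsPlanar ps h)
    (hps : Function.Injective ps) (hh : Function.Involutive h) {γ γ' : X → ZMod 2}
    (hγ : ∀ p, γ (h p) = γ p) (hγ' : ∀ p, γ' (h p) = γ' p) (hdis : ∀ p, γ p * γ' p = 0)
    (hfix : ∀ p, h p = p → γ' p = 0) :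
    ∑ p, ∑ q, γ p * γ' q * before ps p q = 0 := by
  refine Finset.sum_involution (fun p _ => h p) ?_ ?_ (fun p _ => Finset.mem_univ _)
    (fun p _ => hh p)
  · intro p _
    rw [← Finset.sum_add_distrib]
    refine Finset.sum_involution (fun q _ => h q) ?_ ?_ (fun q _ => Finset.mem_univ _)
      (fun q _ => hh q)
    · intro q _
      rw [hγ, hγ']
      by_cases h1 : q = p
      · subst h1; simp [hdis]
      by_cases h2 : q = h p
      · subst h2; simp [hγ', hdis]
      linear_combination γ p * γ' q * H.arcs hps hh h1 h2
    · intro q _ hne heq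
      exact hne (by simp [hfix q heq])
  · intro p _ hne heq
    refine hne (Finset.sum_involution (fun q _ => h q) ?_ ?_ (fun q _ => Finset.mem_univ _)
      (fun q _ => hh q))
    · intro q _
      rw [hγ']
      linear_combination γ p * γ' q * H.defect hps hh heq q
    · intro q _ hne' heq'
      exact hne' (by simp [hfix q heq'])

/-- The composition of a diagram with a link state is planar: two components of the glued picture
have interleaving numbers `0` modulo `2` in the diagram and in the link state, and the order of the
right points in the diagram is opposite to that in the link state. -/
theorem sum_before_left {γ γ' : Pt m → ZMod 2} (ha : ∀ p, γ (a.join p) = γ p)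
    (ha' : ∀ p, γ' (a.join p) = γ' p) (hv : ∀ p, γ (v.ext p) = γ p)
    (hv' : ∀ p, γ' (v.ext p) = γ' p) (hdis : ∀ p, γ p * γ' p = 0)
    (hfix : ∀ i, v.join i = i → γ' (Sum.inr i) = 0) :
    ∑ i : Fin m, ∑ j : Fin m,
      γ (Sum.inl i) * γ' (Sum.inl j) * before (fun i : Fin m => (i : ℕ)) i j = 0 := by
  have two : ∀ z : ZMod 2, z + z = 0 := CharTwo.add_self_eq_zero
  have A := a.isPlanar.sum_eq_zero (pos_injective m) a.join_join ha ha' hdis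
    fun p hp => absurd hp (a.join_ne p)
  have B := v.isPlanar.sum_eq_zero Fin.val_injective v.join_join
    (γ := fun i => γ (Sum.inr i)) (γ' := fun i => γ' (Sum.inr i))
    (fun i => hv (Sum.inr i)) (fun i => hv' (Sum.inr i)) (fun i => hdis _) hfix
  have C : ∑ p, γ p = 0 := by
    refine Finset.sum_involution (fun p _ => a.join p) ?_ (fun p _ _ => a.join_ne p)
      (fun p _ => Finset.mem_univ _) (fun p _ => a.join_join p)
    intro p _
    rw [ha, two]
  simp only [Fintype.sum_sum_type] at A C
  have b1 : ∀ i j : Fin m, before pos (Sum.inl i : Pt m) (Sum.inl j) =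
      before (fun i : Fin m => (i : ℕ)) i j := fun i j => rfl
  have b2 : ∀ i j : Fin m, before pos (Sum.inl i : Pt m) (Sum.inr j) = 1 := by
    refine fun i j => before_of_lt ?_
    simp only [pos]
    omega
  have b3 : ∀ i j : Fin m, before pos (Sum.inr i : Pt m) (Sum.inl j) = 0 := by
    refine fun i j => before_of_not_lt ?_
    simp only [pos]
    omega
  have b4 : ∀ i j : Fin m, γ (Sum.inr i) * γ' (Sum.inr j) *
      before pos (Sum.inr i : Pt m) (Sum.inr j) =
      γ (Sum.inr i) * γ' (Sum.inr j) +
        γ (Sum.inr i) * γ' (Sum.inr j) * before (fun i : Fin m => (i : ℕ)) i j := by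
    intro i j
    by_cases hij : i = j
    · subst hij; simp [hdis]
    have hij' : (i : ℕ) ≠ j := fun e => hij (Fin.ext e)
    by_cases h : (i : ℕ) < j
    · rw [before_of_not_lt (by simp only [pos]; omega), before_of_lt h, mul_one, two, mul_zero]
    · rw [before_of_lt (by simp only [pos]; omega), before_of_not_lt h, mul_zero, mul_one,
        add_zero]
  simp only [b1, b2, b3, b4, mul_zero, mul_one, Finset.sum_const_zero, zero_add,
    Finset.sum_add_distrib, ← Finset.mul_sum, ← Finset.sum_mul] at A
  rw [B, add_zero] at A
  linear_combination A - (∑ j : Fin m, γ' (Sum.inr j)) * C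

end Act

section Composition

variable {m k : ℕ} {a : Diagram m} {v : LinkState m k}

/-- If no two defects of `v` become connected with each other, then the concatenation of `a` and `v`
is a link state. -/
theorem exists_actsTo (a : Diagram m) (v : LinkState m k)
    (hd : ∀ i j, v.join i = i → v.join j = j →
      orb a.join v.ext (Sum.inr i) = orb a.join v.ext (Sum.inr j) → i = j) :
    ∃ w : LinkState m k, ActsTo a v w := by
  classical
  have other := fun {x} (hx : v.ext x = x) =>
    exists_other_end (f := a.join) (g := v.ext) a.join_join v.ext_involutive a.join_ne hx
  -- At most two left points lie on one component.
  have three : ∀ {x y z : Pt m}, v.ext x = x → v.ext y = y → v.ext z = z →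
      orb a.join v.ext x = orb a.join v.ext y → orb a.join v.ext x = orb a.join v.ext z →
      x = y ∨ x = z ∨ y = z := by
    intro x y z hx hy hz hxy hxz
    obtain ⟨u, -, -, -, hu⟩ := other hx
    have h1 := hu y hy hxy.symm
    have h2 := hu z hz hxz.symm
    grind
  have hex : ∃ w : Fin m → Fin m, ∀ i j, i ≠ j →
      (w i = j ↔ orb a.join v.ext (Sum.inl i) = orb a.join v.ext (Sum.inl j)) := by
    have : ∀ i, ∃ l, ∀ j, i ≠ j →
        (l = j ↔ orb a.join v.ext (Sum.inl i) = orb a.join v.ext (Sum.inl j)) := by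
      intro i
      by_cases h : ∃ l, i ≠ l ∧ orb a.join v.ext (Sum.inl i) = orb a.join v.ext (Sum.inl l)
      · obtain ⟨l, hil, hl⟩ := h
        refine ⟨l, fun j hij => ⟨fun e => e ▸ hl, fun hj => ?_⟩⟩
        have := three (v.ext_inl i) (v.ext_inl l) (v.ext_inl j) hl hj
        simp only [Sum.inl.injEq] at this
        grind
      · exact ⟨i, fun j hij => ⟨fun e => absurd e hij, fun e => absurd ⟨j, hij, e⟩ h⟩⟩
    exact Classical.axiomOfChoice this
  obtain ⟨w, hw⟩ := hex
  have horb : ∀ i, orb a.join v.ext (Sum.inl (w i)) = orb a.join v.ext (Sum.inl i) := by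
    intro i
    by_cases h : w i = i
    · rw [h]
    · exact ((hw i (w i) (Ne.symm h)).1 rfl).symm
  have hww : Function.Involutive w := by
    intro i
    by_cases h : w i = i
    · rw [h, h]
    · exact (hw (w i) i h).2 (horb i)
  have hmem : ∀ i j, orb a.join v.ext (Sum.inl j) = orb a.join v.ext (Sum.inl i) ↔
      j = i ∨ j = w i := by
    intro i j
    constructor
    · intro h
      by_cases hij : i = j
      · exact Or.inl hij.symm
      · exact Or.inr ((hw i j hij).2 h.symm).symm
    · rintro (rfl | rfl)
      · rfl
      · exact horb i
  -- The indicator functions of two components serve as weights in `sum_before_left`.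
  have cross : ∀ i j, w j ≠ j →
      orb a.join v.ext (Sum.inl i) ≠ orb a.join v.ext (Sum.inl j) →
      ∑ x : Fin m, ∑ y : Fin m, (if x = i ∨ x = w i then 1 else 0) *
        (if y = j ∨ y = w j then 1 else 0) * before (fun i : Fin m => (i : ℕ)) x y = 0 := by
    intro i j hj hij
    have := sum_before_left (a := a) (v := v)
      (γ := fun p => if orb a.join v.ext p = orb a.join v.ext (Sum.inl i) then 1 else 0)
      (γ' := fun p => if orb a.join v.ext p = orb a.join v.ext (Sum.inl j) then 1 else 0)
      (fun p => by simp only [orb_left]) (fun p => by simp only [orb_left])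
      (fun p => by simp only [orb_right]) (fun p => by simp only [orb_right])
      (fun p => by split_ifs with h1 h2 <;> simp; exact hij (h1.symm.trans h2))
      (fun l hl => by
        refine if_neg fun h => ?_
        have := three ((v.ext_inr_eq_iff l).2 hl) (v.ext_inl j) (v.ext_inl (w j)) h
          (h.trans (horb j).symm)
        simp at this
        exact hj this.symm)
    simpa only [hmem] using this
  have pick : ∀ (i : Fin m) (F : Fin m → ZMod 2), w i ≠ i →
      ∑ x, (if x = i ∨ x = w i then 1 else 0) * F x = F i + F (w i) := by
    intro i F hi
    rw [← Finset.sum_pair (Ne.symm hi)]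
    simp [ite_mul, ← Finset.sum_filter]
    congr 1
    ext x; simp
  have pick1 : ∀ (i : Fin m) (F : Fin m → ZMod 2), w i = i →
      ∑ x, (if x = i ∨ x = w i then 1 else 0) * F x = F i := by
    intro i F hi
    simp [hi]
  have lt : ∀ {i j : Fin m}, i < j → before (fun i : Fin m => (i : ℕ)) i j = 1 :=
    fun h => before_of_lt h
  have gt : ∀ {i j : Fin m}, i < j → before (fun i : Fin m => (i : ℕ)) j i = 0 :=
    fun h => before_of_not_lt (by simpa using h.le)
  have hfixed : ∀ i, w i = i → ∃ d : {d // v.join d = d},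
      orb a.join v.ext (Sum.inr d.1) = orb a.join v.ext (Sum.inl i) := by
    intro i hi
    obtain ⟨y, hy1, hy2, hy3, -⟩ := other (v.ext_inl i)
    rcases y with j | d
    · rcases (hmem i j).1 hy3 with rfl | rfl
      · exact absurd rfl hy1
      · exact absurd (congrArg Sum.inl hi) hy1
    · exact ⟨⟨d, by simpa using hy2⟩, hy3⟩
  refine ⟨⟨w, hww, ?_, ?_, ?_⟩, (actsTo_iff a v _).2 ⟨hd, hw⟩⟩
  · rintro i j ⟨h1, h2, h3⟩
    have hi : w i ≠ i := (h1.trans h2).ne'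
    have hj : w j ≠ j := (h2.trans h3).ne'
    have hij : orb a.join v.ext (Sum.inl i) ≠ orb a.join v.ext (Sum.inl j) := fun h =>
      h2.ne ((hw i j h1.ne).2 h).symm
    have := cross i j hj hij
    simp only [mul_assoc, ← Finset.mul_sum] at this
    rw [pick i _ hi, pick j _ hj, pick j _ hj, lt h1, lt (h1.trans (h2.trans h3)), gt h2,
      lt h3] at this
    exact absurd this (by decide)
  · rintro i j hj ⟨h1, h2⟩
    have hi : w i ≠ i := (h1.trans h2).ne'
    have hij : orb a.join v.ext (Sum.inl j) ≠ orb a.join v.ext (Sum.inl i) := fun h =>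
      h2.ne ((hw i j h1.ne).2 h.symm).symm
    have := cross j i hi hij
    simp only [mul_assoc, ← Finset.mul_sum] at this
    rw [pick1 j _ hj, pick i _ hi, gt h1, lt h2] at this
    exact absurd this (by decide)
  · choose D hD using fun i : {i // w i = i} => hfixed i.1 i.2
    rw [← v.card_defects]
    refine Nat.card_congr (Equiv.ofBijective D ⟨?_, ?_⟩)
    · intro i j hij
      have h := (hD i).symm.trans ((congrArg (fun d => orb a.join v.ext (Sum.inr d.1)) hij).trans
        (hD j))
      rcases (hmem _ _).1 h with h | h
      · exact Subtype.ext h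
      · exact Subtype.ext (h.trans j.2)
    · rintro ⟨d, hdd⟩
      obtain ⟨y, hy1, hy2, hy3, hy⟩ := other ((v.ext_inr_eq_iff d).2 hdd)
      rcases y with i | e
      · have hi : w i = i := by
          have := three ((v.ext_inr_eq_iff d).2 hdd) (v.ext_inl i) (v.ext_inl (w i)) hy3.symm
            (hy3.symm.trans (horb i).symm)
          simp at this
          exact this.symm
        exact ⟨⟨i, hi⟩, Subtype.ext (hd _ _ (D ⟨i, hi⟩).2 hdd ((hD ⟨i, hi⟩).trans hy3))⟩
      · exact absurd (congrArg Sum.inr (hd _ _ (by simpa using hy2) hdd hy3)) hy1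

end Composition

/-! ### Splices of link states and of diagrams -/

section

theorem orb_comm {X : Type} {f g : X → X} {p q : X} :
    orb f g p = orb f g q ↔ orb g f p = orb g f q :=
  ⟨eq_of_orb_eq (orb g f) (orb_right g f) (orb_left g f),
    eq_of_orb_eq (orb f g) (orb_right f g) (orb_left f g)⟩

theorem card_orb_comm {X : Type} (f g : X → X) : Nat.card (Orb f g) = Nat.card (Orb g f) := by
  refine Nat.card_congr (Quot.congr (Equiv.refl X) fun p q => ?_)
  exact or_comm

variable {m k : ℕ} {i j : Fin m}

/-- The link state in which the strands at the neighbouring points `i` and `j` have been connected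
with each other, and `i` and `j` have been joined by a new arc. -/
def LinkState.splice (w : LinkState m k) (hij : (j : ℕ) = i + 1)
    (h : ¬ (w.join i = i ∧ w.join j = j)) : LinkState m k :=
  have H : IsPlanar (fun i : Fin m => (i : ℕ)) (TemperleyLieb.splice w.join i j) :=
    w.isPlanar.splice Fin.val_injective w.join_join (by rintro rfl; omega)
      (fun q h1 h2 => by
        have h1 : (q : ℕ) ≠ i := fun e => h1 (Fin.ext e)
        have h2 : (q : ℕ) ≠ j := fun e => h2 (Fin.ext e)
        omega) h
  { join := TemperleyLieb.splice w.join i j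
    join_join := splice_involutive w.join_join
    noncrossing := H.1
    defect_free := fun p q => H.2 p q
    card_defects :=
      (card_fixed_splice w.join_join (by rintro rfl; omega) h).trans w.card_defects }

/-- The diagram in which the strands at the neighbouring left points `i` and `j` have been connected
with each other, and `i` and `j` have been joined by a new strand. -/
def Diagram.splice (a : Diagram m) (hij : (j : ℕ) = i + 1) : Diagram m where
  join := TemperleyLieb.splice a.join (Sum.inl i) (Sum.inl j)
  join_join := splice_involutive a.join_join
  join_ne := splice_ne a.join_join (by simpa using fun h => by subst h; omega) a.join_ne
  noncrossing := by
    refine (a.isPlanar.splice (pos_injective m) a.join_join ?_ ?_ ?_).1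
    · simpa using fun h => by subst h; omega
    · intro q h1 h2
      have h1 : pos q ≠ pos (Sum.inl i) := fun e => h1 (pos_injective m e)
      have h2 : pos q ≠ pos (Sum.inl j) := fun e => h2 (pos_injective m e)
      simp only [pos] at h1 h2 ⊢
      omega
    · exact fun h => a.join_ne _ h.1

theorem LinkState.ext_splice (w : LinkState m k) (hij : (j : ℕ) = i + 1)
    (h : ¬ (w.join i = i ∧ w.join j = j)) :
    (w.splice hij h).ext = TemperleyLieb.splice w.ext (Sum.inr i) (Sum.inr j) := by
  funext p
  rcases p with p | p
  · simp [TemperleyLieb.splice]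
  · simp only [ext_inr, LinkState.splice, TemperleyLieb.splice, Sum.inr.injEq]
    split_ifs <;> rfl

/-- Splicing a link state with the strand between the right points `i` and `j` of a diagram cuts off
a closed loop. -/
theorem cutsOff_right {a : Diagram m} (w : LinkState m k) (hij : i ≠ j)
    (ha : a.join (Sum.inr i) = Sum.inr j) (hw : w.join i ≠ j)
    (h : ¬ (w.join i = i ∧ w.join j = j)) :
    CutsOff w.ext a.join (Sum.inr i) (Sum.inr j) {Sum.inr i, Sum.inr j} := by
  have ha' : a.join (Sum.inr j) = Sum.inr i := by rw [← ha, a.join_join]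
  have hw' : w.join j ≠ i := fun e => hw (by rw [← e, w.join_join])
  have hji := hij.symm
  refine ⟨w.ext_involutive, a.join_join, by simp, by simp, ?_, ?_, ?_, ?_, ?_, ?_, ?_⟩
  · rintro p (rfl | rfl) <;> simp [ha, ha']
  · rintro p (rfl | rfl) <;> simp
  · simp [hw, em]
  · simp [hw', em]
  · simpa using h
  · rintro p (rfl | rfl)
    · rfl
    · rw [← ha, orb_right]
  · rintro p (rfl | rfl) <;> simp

theorem orb_right_cap {a : Diagram m} (w : LinkState m k)
    (ha : a.join (Sum.inr i) = Sum.inr j) :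
    orb w.ext a.join (Sum.inr i) = orb w.ext a.join (Sum.inr j) := by
  rw [← ha, orb_right]

/-- If a diagram joins the right points `i` and `j`, then it does not distinguish a link state from
its splice at `i` and `j`, up to the closed loop that the splice cuts off. -/
theorem actsTo_splice {a : Diagram m} (w w' : LinkState m k) (hij : (j : ℕ) = i + 1)
    (ha : a.join (Sum.inr i) = Sum.inr j) (hw : w.join i ≠ j)
    (h : ¬ (w.join i = i ∧ w.join j = j)) :
    (ActsTo a (w.splice hij h) w' ↔ ActsTo a w w') ∧
      actLoops a (w.splice hij h) = actLoops a w + 1 := by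
  have hne : i ≠ j := by rintro rfl; omega
  have H := cutsOff_right w hne ha hw h
  have hxy := orb_right_cap w ha
  have hor : ∀ {p q : Pt m}, p ∉ ({Sum.inr i, Sum.inr j} : Set (Pt m)) →
      q ∉ ({Sum.inr i, Sum.inr j} : Set (Pt m)) →
      (orb a.join (w.splice hij h).ext p = orb a.join (w.splice hij h).ext q ↔
        orb a.join w.ext p = orb a.join w.ext q) := by
    intro p q hp hq
    rw [orb_comm, LinkState.ext_splice, H.orb_eq_iff hp hq, orb_comm]
    unfold mergedOrb
    grind
  constructor
  · rw [actsTo_iff, actsTo_iff]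
    refine and_congr ?_ (forall₃_congr fun p q hpq => ?_)
    · have hjoin : (w.splice hij h).join = TemperleyLieb.splice w.join i j := rfl
      have hi := w.join_join i
      have hj := w.join_join j
      have step : ∀ p, orb a.join w.ext (Sum.inr (w.join p)) = orb a.join w.ext (Sum.inr p) :=
        fun p => orb_right a.join w.ext (Sum.inr p)
      have hxy' := orb_comm.1 hxy
      -- The defects of the splice correspond to those of `w`, within each component.
      have τ : ∀ d, (w.splice hij h).join d = d → d ≠ i ∧ d ≠ j ∧
          ∃ e, w.join e = e ∧ orb a.join w.ext (Sum.inr d) = orb a.join w.ext (Sum.inr e) ∧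
            d = if e = i then w.join j else if e = j then w.join i else e := by
        intro d hd
        rw [hjoin] at hd
        have hd2 := w.join_join d
        have h1 : d ≠ i ∧ d ≠ j ∧ (w.join d = d ∨ (w.join d = i ∧ w.join j = j) ∨
            (w.join d = j ∧ w.join i = i)) := by
          unfold TemperleyLieb.splice at hd
          grind
        refine ⟨h1.1, h1.2.1, ?_⟩
        rcases h1.2.2 with h2 | ⟨h2, h3⟩ | ⟨h2, h3⟩
        · exact ⟨d, h2, rfl, by grind⟩
        · refine ⟨j, h3, ?_, by grind⟩
          rw [← hxy', ← h2, step]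
        · refine ⟨i, h3, ?_, by grind⟩
          rw [hxy', ← h2, step]
      have τ' : ∀ e, w.join e = e → ∃ d, (w.splice hij h).join d = d ∧ d ≠ i ∧ d ≠ j ∧
          orb a.join w.ext (Sum.inr d) = orb a.join w.ext (Sum.inr e) ∧
          e = if w.join d = d then d else if w.join d = i then j else i := by
        intro e he
        rw [hjoin]
        by_cases h1 : e = i
        · subst h1
          refine ⟨w.join j, ?_, ?_, ?_, ?_, ?_⟩
          · unfold TemperleyLieb.splice; grind
          · grind
          · grind
          · rw [step, hxy']
          · grind
        by_cases h2 : e = j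
        · subst h2
          refine ⟨w.join i, ?_, ?_, ?_, ?_, ?_⟩
          · unfold TemperleyLieb.splice; grind
          · grind
          · grind
          · rw [step, hxy']
          · grind
        refine ⟨e, ?_, h1, h2, rfl, by grind⟩
        unfold TemperleyLieb.splice; grind
      constructor
      · intro H1 d e hd he hde
        obtain ⟨d', hd', hdi, hdj, hod, hed⟩ := τ' d hd
        obtain ⟨e', he', hei, hej, hoe, hee⟩ := τ' e he
        have := H1 d' e' hd' he' ((hor (by simp [hdi, hdj]) (by simp [hei, hej])).2
          (hod.trans (hde.trans hoe.symm)))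
        rw [hed, hee, this]
      · intro H1 d e hd he hde
        obtain ⟨hdi, hdj, d', hd', hod, hed⟩ := τ d hd
        obtain ⟨hei, hej, e', he', hoe, hee⟩ := τ e he
        rw [hor (by simp [hdi, hdj]) (by simp [hei, hej])] at hde
        rw [hed, hee, H1 d' e' hd' he' (hod.symm.trans (hde.trans hoe))]
    · rw [hor (by simp) (by simp)]
  -- The numbers of loops follow from those of all orbits, as the numbers of end points agree.
  · have h1 := two_mul_card_orb (f := a.join) (g := w.ext) a.join_join w.ext_involutive a.join_ne
    have h2 := two_mul_card_orb (f := a.join) (g := (w.splice hij h).ext) a.join_join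
      (w.splice hij h).ext_involutive a.join_ne
    have h3 := H.card_orb
    rw [if_pos hxy, ← LinkState.ext_splice w hij h, card_orb_comm, card_orb_comm w.ext] at h3
    rw [LinkState.ext_splice, card_fixed_splice w.ext_involutive (by simpa using hne)
      (by simpa using h), ← LinkState.ext_splice w hij h] at h2
    rw [actLoops_eq, actLoops_eq]
    omega

end

section

variable {m k : ℕ} {i j : Fin m}

/-- A defect of a concatenation is connected to a defect of the link state. -/
theorem ActsTo.exists_defect {a : Diagram m} {v w : LinkState m k} (h : ActsTo a v w) {i : Fin m}
    (hi : w.join i = i) :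
    ∃ d, v.join d = d ∧ orb a.join v.ext (Sum.inr d) = orb a.join v.ext (Sum.inl i) := by
  obtain ⟨y, hy1, hy2, hy3, -⟩ :=
    exists_other_end (f := a.join) a.join_join v.ext_involutive a.join_ne (v.ext_inl i)
  rcases y with l | d
  · have hil : i ≠ l := fun e => hy1 (congrArg Sum.inl e.symm)
    exact absurd (hi.symm.trans ((((actsTo_iff a v w).1 h).2 i l hil).2 hy3.symm)) hil
  · exact ⟨d, by simpa using hy2, hy3⟩

theorem ActsTo.join_eq_of_defect {a : Diagram m} {v w : LinkState m k} (h : ActsTo a v w)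
    {i d : Fin m} (hd : v.join d = d)
    (hid : orb a.join v.ext (Sum.inr d) = orb a.join v.ext (Sum.inl i)) : w.join i = i := by
  by_contra hne
  have h1 := (((actsTo_iff a v w).1 h).2 i (w.join i) (Ne.symm hne)).1 rfl
  obtain ⟨y, -, -, -, hy⟩ :=
    exists_other_end (f := a.join) a.join_join v.ext_involutive a.join_ne (v.ext_inl i)
  have h2 := hy _ (v.ext_inl (w.join i)) h1.symm
  have h3 := hy _ ((v.ext_inr_eq_iff d).2 hd) hid
  simp only [Sum.inl.injEq, reduceCtorEq, false_or] at h2 h3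
  rcases h2 with h2 | h2
  · exact hne h2
  · rw [← h2] at h3
    cases h3

/-- Splicing a diagram at the left points `i` and `j`, which are ends of the concatenation with a
link state, cuts off a component. -/
theorem cutsOff_left {a : Diagram m} (v : LinkState m k)
    (ha : a.join (Sum.inl i) ≠ Sum.inl j) :
    CutsOff a.join v.ext (Sum.inl i) (Sum.inl j) {Sum.inl i, Sum.inl j} := by
  have ha' : a.join (Sum.inl j) ≠ Sum.inl i := fun e => ha (by rw [← e, a.join_join])
  refine ⟨a.join_join, v.ext_involutive, by simp, by simp, ?_, ?_, ?_, ?_, ?_, ?_, ?_⟩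
  · rintro p (rfl | rfl) <;> simp
  · rintro p (rfl | rfl) <;> simp
  · simp [ha, a.join_ne]
  · simp [ha', a.join_ne]
  · exact fun h => a.join_ne _ h.1
  · rintro p (rfl | rfl)
    · rfl
    · rw [← orb_left _ _ (Sum.inl i), splice_left]
  · rintro p (rfl | rfl) <;> simp

section

variable {a : Diagram m} {v : LinkState m k}

/-- If the splice of `a` acts on `v`, then the merging of the components of `i` and `j` does not
connect two defects. -/
theorem mergedOrb_of_actsTo_splice (hij : (j : ℕ) = i + 1)
    (ha : a.join (Sum.inl i) ≠ Sum.inl j) {w'' : LinkState m k} (h : ActsTo (a.splice hij) v w'')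
    {d e : Fin m} (hd : v.join d = d) (he : v.join e = e)
    (hde : mergedOrb a.join v.ext (Sum.inl i) (Sum.inl j) (Sum.inr d) =
      mergedOrb a.join v.ext (Sum.inl i) (Sum.inl j) (Sum.inr e)) : d = e :=
  ((actsTo_iff _ _ _).1 h).1 d e hd he
    (((cutsOff_left v ha).orb_eq_iff (by simp) (by simp)).2 hde)

/-- If the splice of `a` acts on `v` without connecting defects, then so does `a`. -/
theorem exists_actsTo_of_splice (hij : (j : ℕ) = i + 1)
    (ha : a.join (Sum.inl i) ≠ Sum.inl j) {w'' : LinkState m k} (h : ActsTo (a.splice hij) v w'') :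
    ∃ w', ActsTo a v w' := by
  refine exists_actsTo a v fun d e hd he hde =>
    mergedOrb_of_actsTo_splice hij ha h hd he ?_
  unfold mergedOrb
  rw [hde]

theorem not_both_of_actsTo_splice (hij : (j : ℕ) = i + 1)
    (ha : a.join (Sum.inl i) ≠ Sum.inl j) {w' w'' : LinkState m k} (h' : ActsTo a v w')
    (h : ActsTo (a.splice hij) v w'') : ¬ (w'.join i = i ∧ w'.join j = j) := by
  rintro ⟨h1, h2⟩
  obtain ⟨d, hd, hid⟩ := h'.exists_defect h1
  obtain ⟨e, he, hje⟩ := h'.exists_defect h2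
  have hde := mergedOrb_of_actsTo_splice hij ha h hd he (by unfold mergedOrb; grind)
  subst hde
  have hne : i ≠ j := by rintro rfl; omega
  have := (((actsTo_iff _ _ _).1 h').2 i j hne).2 (hid.symm.trans hje)
  exact hne (h1.symm.trans this)

/-- The splice of a diagram `a` at two left points acts as `a` followed by the splice of link
states, with one more closed loop if `a` closes an arc onto the two points. -/
theorem actsTo_diagram_splice (hij : (j : ℕ) = i + 1)
    (ha : a.join (Sum.inl i) ≠ Sum.inl j) {w' : LinkState m k} (h' : ActsTo a v w')
    (hb : ¬ (w'.join i = i ∧ w'.join j = j)) :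
    ActsTo (a.splice hij) v (w'.splice hij hb) ∧
      actLoops (a.splice hij) v = actLoops a v + if w'.join i = j then 1 else 0 := by
  have hne : i ≠ j := by rintro rfl; omega
  have H := cutsOff_left v ha
  have hO := ((actsTo_iff _ _ _).1 h').2
  have hjoin : (a.splice hij).join =
    TemperleyLieb.splice a.join (Sum.inl i) (Sum.inl j) := rfl
  have hO' : ∀ p q, orb a.join v.ext (Sum.inl p) = orb a.join v.ext (Sum.inl q) ↔
      p = q ∨ w'.join p = q := by
    intro p q
    by_cases hpq : p = q
    · simp [hpq]
    · rw [← hO p q hpq]; simp [hpq]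
  constructor
  · rw [actsTo_iff]
    refine ⟨fun d e hd he hde => ?_, fun p q hpq => ?_⟩
    · rw [hjoin, H.orb_eq_iff (by simp) (by simp)] at hde
      have h1 := ((actsTo_iff _ _ _).1 h').1 d e hd he
      have h2 := fun i => h'.join_eq_of_defect (i := i) hd
      have h3 := fun i => h'.join_eq_of_defect (i := i) he
      have := h2 i
      have := h2 j
      have := h3 i
      have := h3 j
      unfold mergedOrb at hde
      grind
    · rw [hjoin]
      change TemperleyLieb.splice w'.join i j p = q ↔ _
      have hp := w'.join_join p
      have hi := w'.join_join i
      have hj := w'.join_join j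
      have hinl : ∀ p, Sum.inl p ∈ ({Sum.inl i, Sum.inl j} : Set (Pt m)) ↔ p = i ∨ p = j := by
        simp
      have hc : orb (TemperleyLieb.splice a.join (Sum.inl i) (Sum.inl j)) v.ext (Sum.inl j) =
          orb (TemperleyLieb.splice a.join (Sum.inl i) (Sum.inl j)) v.ext (Sum.inl i) :=
        H.conn _ (by simp)
      have hon := fun p hp => H.orb_ne (p := Sum.inl p) (mt (hinl p).1 hp)
      by_cases hpT : p = i ∨ p = j
      · have e1 : orb (TemperleyLieb.splice a.join (Sum.inl i) (Sum.inl j)) v.ext (Sum.inl p) =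
            orb (TemperleyLieb.splice a.join (Sum.inl i) (Sum.inl j)) v.ext (Sum.inl i) := by
          rcases hpT with rfl | rfl
          · rfl
          · exact hc
        by_cases hqT : q = i ∨ q = j
        · have e2 : orb (TemperleyLieb.splice a.join (Sum.inl i) (Sum.inl j)) v.ext (Sum.inl q) =
              orb (TemperleyLieb.splice a.join (Sum.inl i) (Sum.inl j)) v.ext (Sum.inl i) := by
            rcases hqT with rfl | rfl
            · rfl
            · exact hc
          simp only [e1, e2, iff_true]
          unfold TemperleyLieb.splice
          grind
        · have := hon q hqT
          rw [e1]
          refine ⟨fun e => ?_, fun e => absurd e.symm this⟩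
          unfold TemperleyLieb.splice at e
          grind
      · by_cases hqT : q = i ∨ q = j
        · have e2 : orb (TemperleyLieb.splice a.join (Sum.inl i) (Sum.inl j)) v.ext (Sum.inl q) =
              orb (TemperleyLieb.splice a.join (Sum.inl i) (Sum.inl j)) v.ext (Sum.inl i) := by
            rcases hqT with rfl | rfl
            · rfl
            · exact hc
          have := hon p hpT
          rw [e2]
          refine ⟨fun e => ?_, fun e => absurd e this⟩
          unfold TemperleyLieb.splice at e
          grind
        · rw [H.orb_eq_iff (mt (hinl p).1 hpT) (mt (hinl q).1 hqT)]
          have a1 := hO' p i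
          have a2 := hO' q i
          have a3 := hO' p q
          have a4 := hO' j q
          have a5 := hO' p j
          have hq := w'.join_join q
          unfold TemperleyLieb.splice mergedOrb
          grind
  · have h1 := two_mul_card_orb (f := a.join) (g := v.ext) a.join_join v.ext_involutive a.join_ne
    have h2 := two_mul_card_orb (f := (a.splice hij).join) (g := v.ext) (a.splice hij).join_join
      v.ext_involutive (a.splice hij).join_ne
    have h3 := H.card_orb
    rw [← hjoin] at h3
    have h4 := hO i j hne
    rw [actLoops_eq, actLoops_eq]
    by_cases hw : w'.join i = j
    · rw [if_pos (h4.1 hw)] at h3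
      rw [if_pos hw]
      omega
    · rw [if_neg (mt h4.2 hw)] at h3
      rw [if_neg hw]
      omega

end

/-- Splicing a diagram whose closure runs from the left point `i` to the left point `j` along the
right strand between `i` and `j` cuts off a closed loop. -/
theorem closeLoops_splice {a : Diagram m} (hij : (j : ℕ) = i + 1)
    (ha : a.join (Sum.inr i) = Sum.inr j) (hl : a.join (Sum.inl i) ≠ Sum.inl j) :
    closeLoops (a.splice hij) = closeLoops a + 1 := by
  have hne : i ≠ j := by rintro rfl; omega
  have ha' : a.join (Sum.inr j) = Sum.inr i := by rw [← ha, a.join_join]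
  have hl' : a.join (Sum.inl j) ≠ Sum.inl i := fun e => hl (by rw [← e, a.join_join])
  have hr : ∀ p i', a.join p = Sum.inr i' → p = a.join (Sum.inr i') := fun p i' e => by
    rw [← e, a.join_join]
  set T : Set (Pt m) := {Sum.inl i, Sum.inl j, Sum.inr i, Sum.inr j} with hT
  have hc : ∀ f : Pt m → Pt m, f (Sum.inr i) = Sum.inr j → ∀ p ∈ T,
      orb f Sum.swap p = orb f Sum.swap (Sum.inl i) := by
    intro f hf
    have h1 : orb f Sum.swap (Sum.inr i) = orb f Sum.swap (Sum.inl i) :=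
      orb_right f Sum.swap (Sum.inl i)
    have h2 : orb f Sum.swap (Sum.inr j) = orb f Sum.swap (Sum.inr i) := by
      rw [← hf, orb_left]
    have h3 : orb f Sum.swap (Sum.inl j) = orb f Sum.swap (Sum.inr j) :=
      orb_right f Sum.swap (Sum.inr j)
    rintro p (rfl | rfl | rfl | rfl)
    · rfl
    · exact h3.trans (h2.trans h1)
    · exact h1
    · exact h2.trans h1
  have H : CutsOff a.join Sum.swap (Sum.inl i) (Sum.inl j) T := by
    refine ⟨a.join_join, Sum.swap_swap, by simp [hT], by simp [hT], ?_, ?_, ?_, ?_, ?_, ?_, ?_⟩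
    · rintro p (rfl | rfl | rfl | rfl) <;> simp [hT]
    · rintro p (rfl | rfl | rfl | rfl) <;> simp [hT, ha, ha']
    · right
      rintro (h | h | h | h)
      · exact a.join_ne _ h
      · exact hl h
      · exact absurd (hr _ _ h) (by simp [ha])
      · exact absurd (hr _ _ h) (by simp [ha'])
    · right
      rintro (h | h | h | h)
      · exact hl' h
      · exact a.join_ne _ h
      · exact absurd (hr _ _ h) (by simp [ha])
      · exact absurd (hr _ _ h) (by simp [ha'])
    · exact fun h => a.join_ne _ h.1
    · exact hc _ (by simp [splice, ha])
    · exact fun p hp => Or.inl (hc _ ha p hp)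
  have h1 := H.card_orb
  rw [if_pos (hc _ ha _ (by simp [hT])).symm] at h1
  exact h1

end

/-! ### The trace of a splice -/

section

variable {m k : ℕ} {i j : Fin m}

open Classical in
/-- The matrix, on the standard module, of the splice of link states at `i` and `j`. A pair of
points that is joined already yields a closed loop, and a pair of defects yields `0`. -/
noncomputable def spliceMatrix (χ : ℂ) (k : ℕ) (i j : Fin m) :
    Matrix (LinkState m k) (LinkState m k) ℂ :=
  Matrix.of fun w' w =>
    if ¬ (w.join i = i ∧ w.join j = j) ∧ w'.join = TemperleyLieb.splice w.join i j then
      (if w.join i = j then χ else 1) else 0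

theorem spliceMatrix_of_not_both (χ : ℂ) (hij : (j : ℕ) = i + 1) (w w' : LinkState m k)
    (h : ¬ (w.join i = i ∧ w.join j = j)) [Decidable (w' = w.splice hij h)] :
    spliceMatrix χ k i j w' w =
      if w' = w.splice hij h then (if w.join i = j then χ else 1) else 0 := by
  simp only [spliceMatrix, Matrix.of_apply, h, not_false_eq_true, true_and]
  refine if_congr ⟨fun e => LinkState.join_injective _ _ e, fun e => e ▸ rfl⟩ rfl rfl

theorem spliceMatrix_of_both (χ : ℂ) (w w' : LinkState m k)
    (h : w.join i = i ∧ w.join j = j) : spliceMatrix χ k i j w' w = 0 := by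
  simp [spliceMatrix, h]

theorem actMatrix_mul_spliceMatrix (χ : ℂ) (k : ℕ) {a : Diagram m} (hij : (j : ℕ) = i + 1)
    (ha : a.join (Sum.inr i) = Sum.inr j) :
    actMatrix χ k a * spliceMatrix χ k i j = χ • actMatrix χ k a := by
  classical
  have hne : i ≠ j := by rintro rfl; omega
  ext w' w
  rw [Matrix.mul_apply, Matrix.smul_apply, smul_eq_mul]
  by_cases h : w.join i = i ∧ w.join j = j
  · simp only [spliceMatrix_of_both χ w _ h, mul_zero, Finset.sum_const_zero]
    rw [actMatrix, Matrix.of_apply, if_neg, mul_zero]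
    intro hw
    refine hne (((actsTo_iff _ _ _).1 hw).1 i j h.1 h.2 ?_)
    rw [← ha, orb_left]
  · simp only [spliceMatrix_of_not_both χ hij w _ h, mul_ite, mul_zero, Finset.sum_ite_eq',
      Finset.mem_univ, if_true]
    by_cases hw : w.join i = j
    · have : w.splice hij h = w :=
        LinkState.join_injective _ _ (splice_eq_self w.join_join hw)
      rw [this, if_pos hw, mul_comm]
    · obtain ⟨h1, h2⟩ := actsTo_splice w w' hij ha hw h
      simp only [actMatrix, Matrix.of_apply, h1, h2, if_neg hw, mul_one]
      split_ifs
      · rw [pow_succ, mul_comm]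
      · rw [mul_zero]

theorem spliceMatrix_mul_actMatrix (χ : ℂ) (k : ℕ) {a : Diagram m} (hij : (j : ℕ) = i + 1)
    (ha : a.join (Sum.inl i) ≠ Sum.inl j) :
    spliceMatrix χ k i j * actMatrix χ k a = actMatrix χ k (a.splice hij) := by
  classical
  ext w'' v
  rw [Matrix.mul_apply]
  by_cases h : ∃ w', ActsTo a v w'
  · obtain ⟨w', hw'⟩ := h
    rw [Finset.sum_eq_single w' (fun u _ hu => by
      rw [actMatrix, Matrix.of_apply, if_neg fun e => hu (e.unique hw'), mul_zero])
      (fun h => absurd (Finset.mem_univ _) h)]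
    rw [actMatrix, actMatrix, Matrix.of_apply, Matrix.of_apply, if_pos hw']
    by_cases hb : w'.join i = i ∧ w'.join j = j
    · rw [spliceMatrix_of_both χ _ _ hb, if_neg fun e =>
        not_both_of_actsTo_splice hij ha hw' e hb, zero_mul]
    · obtain ⟨h1, h2⟩ := actsTo_diagram_splice hij ha hw' hb
      rw [spliceMatrix_of_not_both χ hij _ _ hb, h2]
      by_cases e : w'' = w'.splice hij hb
      · subst e
        rw [if_pos rfl, if_pos h1]
        split_ifs <;> ring
      · rw [if_neg e, if_neg fun h => e (h.unique h1), zero_mul]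
  · push Not at h
    rw [Finset.sum_eq_zero fun u _ => by
      rw [actMatrix, Matrix.of_apply, if_neg (h u), mul_zero]]
    rw [actMatrix, Matrix.of_apply, if_neg fun e => ?_]
    obtain ⟨w', hw'⟩ := exists_actsTo_of_splice hij ha e
    exact h w' hw'

/-- A diagram `a` with a strand between the right points `i` and `j` factors through the splice of
link states at `i` and `j`; by cyclicity of the trace this splice may be moved to the left side. -/
theorem trace_actMatrix_splice (χ : ℂ) (k : ℕ) {a : Diagram m} (hij : (j : ℕ) = i + 1)
    (ha : a.join (Sum.inr i) = Sum.inr j) (hl : a.join (Sum.inl i) ≠ Sum.inl j) :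
    (actMatrix χ k (a.splice hij)).trace = χ * (actMatrix χ k a).trace := by
  rw [← spliceMatrix_mul_actMatrix χ k hij hl, Matrix.trace_mul_comm,
    actMatrix_mul_spliceMatrix χ k hij ha, Matrix.trace_smul, smul_eq_mul]

end

/-! ### Insertion of opposite arcs -/

section Sum

variable {X Y Z : Type} {f g : X → X} {F G : Y → Y}

theorem orb_conj (e : X ≃ Y) (hf : ∀ s, F (e s) = e (f s)) (hg : ∀ s, G (e s) = e (g s))
    {s t : X} : orb F G (e s) = orb F G (e t) ↔ orb f g s = orb f g t := by
  constructor
  · intro h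
    have := eq_of_orb_eq (fun y => orb f g (e.symm y)) ?_ ?_ h
    · simpa using this
    · intro p
      obtain ⟨s, rfl⟩ := e.surjective p
      simp only [hf, Equiv.symm_apply_apply, orb_left]
    · intro p
      obtain ⟨s, rfl⟩ := e.surjective p
      simp only [hg, Equiv.symm_apply_apply, orb_right]
  · refine eq_of_orb_eq (fun s => orb F G (e s)) (fun s => ?_) (fun s => ?_)
    · simp only [← hf, orb_left]
    · simp only [← hg, orb_right]

theorem card_orb_conj (e : X ≃ Y) (hf : ∀ s, F (e s) = e (f s)) (hg : ∀ s, G (e s) = e (g s)) :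
    Nat.card (Orb F G) = Nat.card (Orb f g) := by
  refine (Nat.card_congr (Quot.congr e fun s t => ?_)).symm
  rw [hf, hg, e.injective.eq_iff, e.injective.eq_iff]

variable {f₀ g₀ : Z → Z}

/-- The orbits on a disjoint union are those of its two parts. -/
theorem exists_orb_sum_equiv :
    ∃ Φ : Orb (Sum.map f f₀) (Sum.map g g₀) ≃ Orb f g ⊕ Orb f₀ g₀,
      (∀ p, Φ (orb _ _ (Sum.inl p)) = Sum.inl (orb f g p)) ∧
      (∀ z, Φ (orb _ _ (Sum.inr z)) = Sum.inr (orb f₀ g₀ z)) := by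
  refine ⟨{ toFun := Quot.lift (Sum.elim (fun p => Sum.inl (orb f g p))
              (fun z => Sum.inr (orb f₀ g₀ z))) ?_
            invFun := Sum.elim
              (Quot.lift (fun p => orb _ _ (Sum.inl p)) ?_)
              (Quot.lift (fun z => orb _ _ (Sum.inr z)) ?_)
            left_inv := ?_
            right_inv := ?_ }, fun p => rfl, fun z => rfl⟩
  · rintro (p | z) _ (rfl | rfl)
    · exact congrArg Sum.inl (orb_left f g p).symm
    · exact congrArg Sum.inl (orb_right f g p).symm
    · exact congrArg Sum.inr (orb_left f₀ g₀ z).symm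
    · exact congrArg Sum.inr (orb_right f₀ g₀ z).symm
  · rintro p _ (rfl | rfl)
    · exact (orb_left (Sum.map f f₀) (Sum.map g g₀) (Sum.inl p)).symm
    · exact (orb_right (Sum.map f f₀) (Sum.map g g₀) (Sum.inl p)).symm
  · rintro p _ (rfl | rfl)
    · exact (orb_left (Sum.map f f₀) (Sum.map g g₀) (Sum.inr p)).symm
    · exact (orb_right (Sum.map f f₀) (Sum.map g g₀) (Sum.inr p)).symm
  · rintro ⟨p | z⟩ <;> rfl
  · rintro (p | z)
    · induction p using Quot.ind
      rfl
    · induction z using Quot.ind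
      rfl

theorem orb_sum_inl {p q : X} :
    orb (Sum.map f f₀) (Sum.map g g₀) (Sum.inl p) = orb (Sum.map f f₀) (Sum.map g g₀) (Sum.inl q) ↔
      orb f g p = orb f g q := by
  obtain ⟨Φ, h1, -⟩ := exists_orb_sum_equiv (f := f) (g := g) (f₀ := f₀) (g₀ := g₀)
  rw [← Φ.injective.eq_iff, h1, h1, Sum.inl.injEq]

theorem orb_sum_ne {p : X} {z : Z} :
    orb (Sum.map f f₀) (Sum.map g g₀) (Sum.inl p) ≠
      orb (Sum.map f f₀) (Sum.map g g₀) (Sum.inr z) := by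
  obtain ⟨Φ, h1, h2⟩ := exists_orb_sum_equiv (f := f) (g := g) (f₀ := f₀) (g₀ := g₀)
  rw [← Φ.injective.ne_iff, h1, h2]
  simp

theorem card_orb_sum [Finite X] [Finite Z] :
    Nat.card (Orb (Sum.map f f₀) (Sum.map g g₀)) = Nat.card (Orb f g) + Nat.card (Orb f₀ g₀) := by
  obtain ⟨Φ, -, -⟩ := exists_orb_sum_equiv (f := f) (g := g) (f₀ := f₀) (g₀ := g₀)
  rw [Nat.card_congr Φ, Nat.card_sum]

/-- Inserting arcs between neighbouring points does not affect planarity. -/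
theorem isPlanar_insert_iff {ps : X → ℕ} {PS : Y → ℕ} (e : X ⊕ Z ≃ Y)
    (hmono : ∀ p q, PS (e (Sum.inl p)) < PS (e (Sum.inl q)) ↔ ps p < ps q)
    (hadj : ∀ z, PS (e (Sum.inr (f₀ z))) = PS (e (Sum.inr z)) + 1 ∨
      PS (e (Sum.inr z)) = PS (e (Sum.inr (f₀ z))) + 1)
    (hF : ∀ s, F (e s) = e (Sum.map f f₀ s)) : IsPlanar PS F ↔ IsPlanar ps f := by
  have hl : ∀ p, F (e (Sum.inl p)) = e (Sum.inl (f p)) := fun p => hF (Sum.inl p)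
  have hr : ∀ z, F (e (Sum.inr z)) = e (Sum.inr (f₀ z)) := fun z => hF (Sum.inr z)
  constructor
  · rintro ⟨h1, h2⟩
    refine ⟨fun p q => ?_, fun p q hq => ?_⟩
    · have := h1 (e (Sum.inl p)) (e (Sum.inl q))
      rwa [hl, hl, hmono, hmono, hmono] at this
    · have := h2 (e (Sum.inl p)) (e (Sum.inl q)) (by rw [hl, hq])
      rwa [hl, hmono, hmono] at this
  · rintro ⟨h1, h2⟩
    refine ⟨fun p q => ?_, fun p q hq => ?_⟩
    · obtain ⟨p | p, rfl⟩ := e.surjective p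
      · obtain ⟨q | q, rfl⟩ := e.surjective q
        · rw [hl, hl, hmono, hmono, hmono]
          exact h1 p q
        · have := hadj q
          rw [hr]
          omega
      · have := hadj p
        rw [hr]
        omega
    · obtain ⟨p | p, rfl⟩ := e.surjective p
      · obtain ⟨q | q, rfl⟩ := e.surjective q
        · rw [hl, hmono, hmono]
          refine h2 p q ?_
          rw [hl] at hq
          exact Sum.inl_injective (e.injective hq)
        · have := hadj q
          rw [hr] at hq
          rw [hq] at this
          omega
      · have := hadj p
        rw [hr]
        omega

/-- An involution that contains the inserted arcs restricts to the other points. -/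
theorem exists_restrict (e : X ⊕ Z ≃ Y) (hF : Function.Involutive F)
    (hr : ∀ z, F (e (Sum.inr z)) = e (Sum.inr (f₀ z))) :
    ∃ f : X → X, Function.Involutive f ∧ ∀ s, F (e s) = e (Sum.map f f₀ s) := by
  have : ∀ p, ∃ q, F (e (Sum.inl p)) = e (Sum.inl q) := by
    intro p
    obtain ⟨q | z, h⟩ := e.surjective (F (e (Sum.inl p)))
    · exact ⟨q, h.symm⟩
    · have h2 := hF (e (Sum.inl p))
      rw [← h, hr] at h2
      exact absurd (e.injective h2) (by simp)
  choose f hf using this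
  refine ⟨f, fun p => ?_, ?_⟩
  · have h2 := hF (e (Sum.inl p))
    rw [hf, hf] at h2
    exact Sum.inl_injective (e.injective h2)
  · rintro (p | z)
    · exact hf p
    · exact hr z

end Sum

section Insertion

variable {m k : ℕ}

/-- The points of a line with `m + 2` points: `m` old ones, and two new neighbouring points, the
first of which is numbered `l`. -/
noncomputable def insertEquiv {m : ℕ} (l : ℕ) (hl : l ≤ m) : Fin m ⊕ Bool ≃ Fin (m + 2) :=
  Equiv.ofBijective
    (Sum.elim (fun x : Fin m => if (x : ℕ) < l then ⟨x, by omega⟩ else ⟨x + 2, by omega⟩)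
      (fun b => if b then ⟨l + 1, by omega⟩ else ⟨l, by omega⟩)) <| by
    refine (Fintype.bijective_iff_injective_and_card _).2 ⟨?_, by simp⟩
    rintro (x | b) (y | c) h <;>
      simp only [Sum.elim_inl, Sum.elim_inr, Fin.ext_iff, Sum.inl.injEq, Sum.inr.injEq] at h ⊢
    · split_ifs at h <;> simp only at h <;> omega
    · split_ifs at h <;> simp only at h <;> omega
    · split_ifs at h <;> simp only at h <;> omega
    · cases b <;> cases c <;> simp at h ⊢

theorem insertEquiv_inl (l : ℕ) (hl : l ≤ m) (x : Fin m) :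
    (insertEquiv l hl (Sum.inl x) : ℕ) = if (x : ℕ) < l then (x : ℕ) else x + 2 := by
  simp only [insertEquiv, Equiv.ofBijective_apply, Sum.elim_inl]
  split_ifs <;> rfl

theorem insertEquiv_false (l : ℕ) (hl : l ≤ m) :
    (insertEquiv l hl (Sum.inr false) : ℕ) = l := rfl

theorem insertEquiv_true (l : ℕ) (hl : l ≤ m) :
    (insertEquiv l hl (Sum.inr true) : ℕ) = l + 1 := rfl

/-- The points of an `m + 2`-diagram: those of an `m`-diagram and two new pairs of neighbouring
points, opposite to each other. -/
noncomputable def insertPt (l : ℕ) (hl : l ≤ m) : Pt m ⊕ (Bool ⊕ Bool) ≃ Pt (m + 2) :=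
  (Equiv.sumSumSumComm _ _ _ _).trans (Equiv.sumCongr (insertEquiv l hl) (insertEquiv l hl))

variable (l : ℕ) (hl : l ≤ m)

@[simp] theorem insertPt_inl_inl (x : Fin m) :
    insertPt l hl (Sum.inl (Sum.inl x)) = Sum.inl (insertEquiv l hl (Sum.inl x)) := rfl

@[simp] theorem insertPt_inl_inr (x : Fin m) :
    insertPt l hl (Sum.inl (Sum.inr x)) = Sum.inr (insertEquiv l hl (Sum.inl x)) := rfl

@[simp] theorem insertPt_inr_inl (b : Bool) :
    insertPt l hl (Sum.inr (Sum.inl b)) = Sum.inl (insertEquiv l hl (Sum.inr b)) := rfl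

@[simp] theorem insertPt_inr_inr (b : Bool) :
    insertPt l hl (Sum.inr (Sum.inr b)) = Sum.inr (insertEquiv l hl (Sum.inr b)) := rfl

theorem pos_insertPt_lt (p q : Pt m) :
    pos (insertPt l hl (Sum.inl p)) < pos (insertPt l hl (Sum.inl q)) ↔ pos p < pos q := by
  rcases p with p | p <;> rcases q with q | q <;>
    simp only [insertPt_inl_inl, insertPt_inl_inr, pos, insertEquiv_inl] <;>
    split_ifs <;> omega

/-- The new strands: one between the two new left points and one between the two new right
points. -/
def newStrands : Bool ⊕ Bool → Bool ⊕ Bool := Sum.map not not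

theorem pos_insertPt_newStrands (z : Bool ⊕ Bool) :
    pos (insertPt l hl (Sum.inr (newStrands z))) = pos (insertPt l hl (Sum.inr z)) + 1 ∨
      pos (insertPt l hl (Sum.inr z)) = pos (insertPt l hl (Sum.inr (newStrands z))) + 1 := by
  rcases z with (_ | _) | (_ | _) <;>
    simp only [newStrands, Sum.map_inl, Sum.map_inr, Bool.not_true, Bool.not_false,
      insertPt_inr_inl, insertPt_inr_inr, pos, insertEquiv_true, insertEquiv_false,
      true_or, or_true] <;>
    omega

/-- `b` is the `m`-diagram `a` with a pair of opposite arcs inserted. -/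
def IsInsertion (a : Diagram m) (b : Diagram (m + 2)) : Prop :=
  ∀ s, b.join (insertPt l hl s) = insertPt l hl (Sum.map a.join newStrands s)

theorem exists_insertion (a : Diagram m) : ∃ b, IsInsertion l hl a b := by
  obtain ⟨F, h0⟩ : ∃ F : Pt (m + 2) → Pt (m + 2),
      ∀ s, F (insertPt l hl s) = insertPt l hl (Sum.map a.join newStrands s) :=
    ⟨fun p => insertPt l hl (Sum.map a.join newStrands ((insertPt l hl).symm p)), by simp⟩
  refine ⟨⟨F, ?_, ?_, ?_⟩, h0⟩
  · intro p
    obtain ⟨s, rfl⟩ := (insertPt l hl).surjective p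
    rw [h0, h0]
    congr 1
    rcases s with p | (b | b) <;> simp [a.join_join, newStrands]
  · intro p
    obtain ⟨s, rfl⟩ := (insertPt l hl).surjective p
    rw [h0, (insertPt l hl).injective.ne_iff]
    rcases s with p | (b | b) <;> simp [a.join_ne, newStrands]
  · exact ((isPlanar_insert_iff (insertPt l hl) (pos_insertPt_lt l hl)
      (pos_insertPt_newStrands l hl) h0).2 a.isPlanar).1

theorem exists_isInsertion_of_join {b : Diagram (m + 2)} {i j : Fin (m + 2)}
    (hil : (i : ℕ) = l) (hij : (j : ℕ) = i + 1) (h1 : b.join (Sum.inl i) = Sum.inl j)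
    (h2 : b.join (Sum.inr i) = Sum.inr j) : ∃ a, IsInsertion l hl a b := by
  have hi : insertEquiv l hl (Sum.inr false) = i := Fin.ext hil.symm
  have hj : insertEquiv l hl (Sum.inr true) = j := Fin.ext (by rw [hij, hil]; rfl)
  have h1' : b.join (Sum.inl j) = Sum.inl i := by rw [← h1, b.join_join]
  have h2' : b.join (Sum.inr j) = Sum.inr i := by rw [← h2, b.join_join]
  obtain ⟨f, hf, hf'⟩ := exists_restrict (F := b.join) (f₀ := newStrands) (insertPt l hl)
    b.join_join (by
      rintro ((_ | _) | (_ | _)) <;>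
        simp [newStrands, hi, hj, h1, h1', h2, h2'])
  refine ⟨⟨f, hf, fun p hp => ?_, ?_⟩, hf'⟩
  · refine b.join_ne (insertPt l hl (Sum.inl p)) ?_
    rw [hf', Sum.map_inl, hp]
  · exact ((isPlanar_insert_iff (insertPt l hl) (pos_insertPt_lt l hl)
      (pos_insertPt_newStrands l hl) hf').1 b.isPlanar).1

theorem card_fixed_insert {F : Fin (m + 2) → Fin (m + 2)} {f : Fin m → Fin m}
    (h : ∀ s, F (insertEquiv l hl s) = insertEquiv l hl (Sum.map f not s)) :
    Nat.card {i // F i = i} = Nat.card {i // f i = i} := by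
  refine (Nat.card_congr (Equiv.ofBijective
    (fun i => ⟨insertEquiv l hl (Sum.inl i.1), by rw [h, Sum.map_inl, i.2]⟩) ⟨?_, ?_⟩)).symm
  · intro i j hij
    exact Subtype.ext (Sum.inl_injective ((insertEquiv l hl).injective (congrArg Subtype.val hij)))
  · rintro ⟨p, hp⟩
    obtain ⟨i | b, rfl⟩ := (insertEquiv l hl).surjective p
    · rw [h] at hp
      exact ⟨⟨i, Sum.inl_injective ((insertEquiv l hl).injective hp)⟩, rfl⟩
    · rw [h] at hp
      simpa using (insertEquiv l hl).injective hp

theorem isPlanar_insertEquiv_iff {F : Fin (m + 2) → Fin (m + 2)} {f : Fin m → Fin m}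
    (h : ∀ s, F (insertEquiv l hl s) = insertEquiv l hl (Sum.map f not s)) :
    IsPlanar (fun i : Fin (m + 2) => (i : ℕ)) F ↔ IsPlanar (fun i : Fin m => (i : ℕ)) f := by
  refine isPlanar_insert_iff (insertEquiv l hl) (fun p q => ?_) ?_ h
  · simp only [insertEquiv_inl]
    split_ifs <;> omega
  · rintro (_ | _)
    · exact Or.inl rfl
    · exact Or.inr rfl

/-- The link state `v` with a new arc inserted. -/
noncomputable def LinkState.insert (v : LinkState m k) : LinkState (m + 2) k :=
  have h0 : ∀ s, (fun p => insertEquiv l hl (Sum.map v.join not ((insertEquiv l hl).symm p)))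
      (insertEquiv l hl s) = insertEquiv l hl (Sum.map v.join not s) := by simp
  have H := (isPlanar_insertEquiv_iff l hl h0).2 v.isPlanar
  { join := fun p => insertEquiv l hl (Sum.map v.join not ((insertEquiv l hl).symm p))
    join_join := by
      intro p
      obtain ⟨i | b, rfl⟩ := (insertEquiv l hl).surjective p <;> simp [v.join_join]
    noncrossing := H.1
    defect_free := fun i j => H.2 i j
    card_defects := (card_fixed_insert l hl h0).trans v.card_defects }

theorem LinkState.insert_join (v : LinkState m k) (s : Fin m ⊕ Bool) :
    (v.insert l hl).join (insertEquiv l hl s) = insertEquiv l hl (Sum.map v.join not s) := by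
  simp [LinkState.insert]

theorem LinkState.insert_injective :
    Function.Injective (LinkState.insert l hl : LinkState m k → LinkState (m + 2) k) := by
  intro v w h
  apply LinkState.join_injective
  funext p
  have h1 := v.insert_join l hl (Sum.inl p)
  rw [h, w.insert_join] at h1
  exact (Sum.inl_injective ((insertEquiv l hl).injective h1)).symm

theorem LinkState.exists_insert (w : LinkState (m + 2) k)
    (h : w.join (insertEquiv l hl (Sum.inr false)) = insertEquiv l hl (Sum.inr true)) :
    ∃ v : LinkState m k, v.insert l hl = w := by
  have h' : w.join (insertEquiv l hl (Sum.inr true)) = insertEquiv l hl (Sum.inr false) := by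
    rw [← h, w.join_join]
  obtain ⟨f, hf, hf'⟩ := exists_restrict (F := w.join) (f₀ := not) (insertEquiv l hl)
    w.join_join (by rintro (_ | _); exacts [h, h'])
  have H := (isPlanar_insertEquiv_iff l hl hf').1 w.isPlanar
  refine ⟨⟨f, hf, H.1, fun i j => H.2 i j, ?_⟩, ?_⟩
  · rw [← card_fixed_insert l hl hf', w.card_defects]
  · apply LinkState.join_injective
    funext p
    obtain ⟨s, rfl⟩ := (insertEquiv l hl).surjective p
    rw [LinkState.insert_join, hf']

end Insertion

section

variable {m k : ℕ} {l : ℕ} {hl : l ≤ m} {a : Diagram m} {b : Diagram (m + 2)}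

theorem LinkState.insert_ext (v : LinkState m k) (s : Pt m ⊕ (Bool ⊕ Bool)) :
    (v.insert l hl).ext (insertPt l hl s) =
      insertPt l hl (Sum.map v.ext (Sum.map id not) s) := by
  rcases s with (x | x) | (x | x) <;> simp [LinkState.insert_join]

/-- The two new strands of a diagram and the new arc of a link state form two components. -/
theorem card_orb_newStrands : Nat.card (Orb newStrands (Sum.map id not : Bool ⊕ Bool → _)) = 2 := by
  have : Nat.card (Orb not id) = 1 ∧ Nat.card (Orb not not) = 1 := by
    constructor <;> refine Nat.card_eq_one_iff_unique.2 ⟨⟨?_⟩, ⟨Quot.mk _ true⟩⟩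
    · rintro ⟨_ | _⟩ ⟨_ | _⟩
      exacts [rfl, orb_left not id true, (orb_left not id true).symm, rfl]
    · rintro ⟨_ | _⟩ ⟨_ | _⟩
      exacts [rfl, orb_left not not true, (orb_left not not true).symm, rfl]
  rw [newStrands, card_orb_sum, this.1, this.2]

theorem IsInsertion.orb_iff (H : IsInsertion l hl a b) (v : LinkState m k)
    {s t : Pt m ⊕ (Bool ⊕ Bool)} :
    orb b.join (v.insert l hl).ext (insertPt l hl s) =
        orb b.join (v.insert l hl).ext (insertPt l hl t) ↔
      orb (Sum.map a.join newStrands) (Sum.map v.ext (Sum.map id not)) s =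
        orb (Sum.map a.join newStrands) (Sum.map v.ext (Sum.map id not)) t :=
  orb_conj (insertPt l hl) H v.insert_ext

theorem IsInsertion.actsTo_iff (H : IsInsertion l hl a b) (v w : LinkState m k) :
    ActsTo b (v.insert l hl) (w.insert l hl) ↔ ActsTo a v w := by
  rw [TemperleyLieb.actsTo_iff, TemperleyLieb.actsTo_iff]
  have e := (insertEquiv l hl).surjective
  have hfix : ∀ x, (v.insert l hl).join (insertEquiv l hl (Sum.inl x)) =
      insertEquiv l hl (Sum.inl x) ↔ v.join x = x := by
    intro x
    rw [LinkState.insert_join, (insertEquiv l hl).injective.eq_iff]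
    simp
  have hinr : ∀ x y, orb b.join (v.insert l hl).ext (Sum.inr (insertEquiv l hl (Sum.inl x))) =
      orb b.join (v.insert l hl).ext (Sum.inr (insertEquiv l hl (Sum.inl y))) ↔
      orb a.join v.ext (Sum.inr x) = orb a.join v.ext (Sum.inr y) := by
    intro x y
    rw [← insertPt_inl_inr, ← insertPt_inl_inr, H.orb_iff, orb_sum_inl]
  have hinl : ∀ x y, orb b.join (v.insert l hl).ext (Sum.inl (insertEquiv l hl (Sum.inl x))) =
      orb b.join (v.insert l hl).ext (Sum.inl (insertEquiv l hl (Sum.inl y))) ↔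
      orb a.join v.ext (Sum.inl x) = orb a.join v.ext (Sum.inl y) := by
    intro x y
    rw [← insertPt_inl_inl, ← insertPt_inl_inl, H.orb_iff, orb_sum_inl]
  have hne : ∀ x c, orb b.join (v.insert l hl).ext (Sum.inl (insertEquiv l hl (Sum.inl x))) ≠
      orb b.join (v.insert l hl).ext (Sum.inl (insertEquiv l hl (Sum.inr c))) := by
    intro x c
    rw [← insertPt_inl_inl, ← insertPt_inr_inl, Ne, H.orb_iff]
    exact orb_sum_ne
  have hnew : ∀ c, orb b.join (v.insert l hl).ext (Sum.inl (insertEquiv l hl (Sum.inr (!c)))) =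
      orb b.join (v.insert l hl).ext (Sum.inl (insertEquiv l hl (Sum.inr c))) := by
    intro c
    rw [← orb_left b.join _ (Sum.inl (insertEquiv l hl (Sum.inr c))), ← insertPt_inr_inl,
      ← insertPt_inr_inl, H]
    rfl
  constructor
  · rintro ⟨h1, h2⟩
    refine ⟨fun x y hx hy hxy => ?_, fun x y hxy => ?_⟩
    · have := h1 _ _ ((hfix x).2 hx) ((hfix y).2 hy) ((hinr x y).2 hxy)
      exact Sum.inl_injective ((insertEquiv l hl).injective this)
    · have := h2 (insertEquiv l hl (Sum.inl x)) (insertEquiv l hl (Sum.inl y))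
        (by simpa using hxy)
      rw [hinl, LinkState.insert_join, (insertEquiv l hl).injective.eq_iff] at this
      simpa using this
  · rintro ⟨h1, h2⟩
    refine ⟨fun p q hp hq hpq => ?_, fun p q hpq => ?_⟩
    · obtain ⟨x | c, rfl⟩ := e p
      · obtain ⟨y | c, rfl⟩ := e q
        · rw [h1 x y ((hfix x).1 hp) ((hfix y).1 hq) ((hinr x y).1 hpq)]
        · rw [LinkState.insert_join] at hq
          simpa using (insertEquiv l hl).injective hq
      · rw [LinkState.insert_join] at hp
        simpa using (insertEquiv l hl).injective hp
    · obtain ⟨x | c, rfl⟩ := e p <;> obtain ⟨y | d, rfl⟩ := e q <;>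
        rw [LinkState.insert_join, (insertEquiv l hl).injective.eq_iff]
      · rw [hinl, ← h2 x y (by simpa using hpq)]
        simp
      · simpa using hne x d
      · simpa using (hne y c).symm
      · have : d = !c := by
          revert hpq
          cases c <;> cases d <;> simp
        subst this
        simp [hnew]

theorem IsInsertion.actLoops_eq (H : IsInsertion l hl a b) (v : LinkState m k) :
    actLoops b (v.insert l hl) = actLoops a v + 1 := by
  have h1 := two_mul_card_orb (f := a.join) a.join_join v.ext_involutive a.join_ne
  have h2 := two_mul_card_orb (f := b.join) b.join_join (v.insert l hl).ext_involutive b.join_ne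
  have h3 : Nat.card (Orb b.join (v.insert l hl).ext) = Nat.card (Orb a.join v.ext) + 2 := by
    rw [card_orb_conj (insertPt l hl) H v.insert_ext, card_orb_sum, card_orb_newStrands]
  have h4 : ∀ {m : ℕ} (u : LinkState m k), Nat.card {p // u.ext p = p} = m + 2 * k := by
    intro m u
    rw [Nat.card_congr (Equiv.subtypeSum), Nat.card_sum]
    have e1 : Nat.card {x : Fin m // u.ext (Sum.inl x) = Sum.inl x} = m := by simp
    rw [e1, ← u.card_defects]
    simp
  rw [h4] at h1 h2
  rw [TemperleyLieb.actLoops_eq, TemperleyLieb.actLoops_eq]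
  omega

theorem IsInsertion.closeLoops_eq (H : IsInsertion l hl a b) :
    closeLoops b = closeLoops a + 1 := by
  have h1 : ∀ s : Pt m ⊕ (Bool ⊕ Bool), Sum.swap (insertPt l hl s) =
      insertPt l hl (Sum.map Sum.swap Sum.swap s) := by
    rintro ((x | x) | (x | x)) <;> simp
  have h2 : Nat.card (Orb newStrands Sum.swap) = 1 := by
    refine Nat.card_eq_one_iff_unique.2 ⟨⟨?_⟩, ⟨Quot.mk _ (Sum.inl true)⟩⟩
    have h3 : ∀ z, orb newStrands Sum.swap z = orb newStrands Sum.swap (Sum.inl true) := by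
      have e1 := orb_left newStrands Sum.swap (Sum.inl true)
      have e2 := orb_right newStrands Sum.swap (Sum.inl true)
      have e3 := orb_right newStrands Sum.swap (Sum.inl false)
      rintro ((_ | _) | (_ | _))
      exacts [e1, rfl, e3.trans e1, e2]
    rintro ⟨z⟩ ⟨z'⟩
    exact (h3 z).trans (h3 z').symm
  have h3 := card_orb_conj (insertPt l hl) H h1
  rw [card_orb_sum, h2] at h3
  exact h3

/-- Inserting a pair of opposite arcs multiplies the traces by the loop value: a link state can only
be fixed by the new diagram if it contains the new arc. -/
theorem IsInsertion.trace_actMatrix (H : IsInsertion l hl a b) (χ : ℂ) (k : ℕ) :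
    (actMatrix χ k b).trace = χ * (actMatrix χ k a).trace := by
  classical
  rw [Matrix.trace, Matrix.trace, Finset.mul_sum]
  symm
  refine Finset.sum_of_injOn (LinkState.insert l hl) (LinkState.insert_injective l hl).injOn
    (fun _ _ => Finset.mem_coe.2 (Finset.mem_univ _)) ?_ ?_
  · intro w _ hw
    simp only [Matrix.diag_apply, actMatrix, Matrix.of_apply]
    rw [if_neg]
    intro h
    obtain ⟨v, hv⟩ := w.exists_insert l hl (by
      refine (((TemperleyLieb.actsTo_iff _ _ _).1 h).2 _ _ (by simp)).2 ?_
      rw [← orb_left b.join _ (Sum.inl _), ← insertPt_inr_inl, H]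
      rfl)
    exact hw ⟨v, by simp, hv⟩
  · intro v _
    simp only [Matrix.diag_apply, actMatrix, Matrix.of_apply, H.actsTo_iff, H.actLoops_eq]
    split_ifs
    · ring
    · ring

end

/-! ### Reduction to the unit -/

/-- The unit of the Temperley-Lieb algebra: all strands run straight from left to right. -/
def Diagram.one (m : ℕ) : Diagram m where
  join := Sum.swap
  join_join := Sum.swap_swap
  join_ne := by rintro (i | i) <;> simp
  noncrossing := by
    rintro (i | i) (j | j) <;> simp only [pos, Sum.swap_inl, Sum.swap_inr] <;> omega

/-- A diagram with a strand between two right points has one between neighbouring right points: an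
innermost one. -/
theorem exists_neighbouring_cap {m : ℕ} (a : Diagram m)
    (h : ∃ i j, a.join (Sum.inr i) = Sum.inr j) :
    ∃ i j : Fin m, (j : ℕ) = i + 1 ∧ a.join (Sum.inr i) = Sum.inr j := by
  have key : ∀ n : ℕ, ∀ i j : Fin m, (j : ℕ) = i + 1 + n → a.join (Sum.inr i) = Sum.inr j →
      ∃ i j : Fin m, (j : ℕ) = i + 1 ∧ a.join (Sum.inr i) = Sum.inr j := by
    intro n
    induction n using Nat.strong_induction_on with
    | _ n ih =>
      intro i j hij hj
      have hj' : a.join (Sum.inr j) = Sum.inr i := by rw [← hj, a.join_join]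
      by_cases hn : n = 0
      · exact ⟨i, j, by omega, hj⟩
      -- The strand at `i + 1` has to end between `i` and `j`.
      set p : Fin m := ⟨i + 1, by omega⟩ with hp
      have hpv : (p : ℕ) = i + 1 := rfl
      have c1 := a.noncrossing (Sum.inr j) (Sum.inr p)
      have c2 := a.noncrossing (a.join (Sum.inr p)) (Sum.inr j)
      have n1 : a.join (Sum.inr p) ≠ Sum.inr i := fun e => by
        have h1 : Sum.inr p = a.join (Sum.inr i) := by rw [← e, a.join_join]
        rw [hj, Sum.inr.injEq, Fin.ext_iff] at h1
        omega
      have n2 : a.join (Sum.inr p) ≠ Sum.inr j := fun e => by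
        have h1 : Sum.inr p = a.join (Sum.inr j) := by rw [← e, a.join_join]
        rw [hj', Sum.inr.injEq, Fin.ext_iff] at h1
        omega
      have n3 := a.join_ne (Sum.inr p)
      rw [hj'] at c1 c2
      rw [a.join_join] at c2
      rcases hq : a.join (Sum.inr p) with q | q
      · rw [hq] at c1 c2
        simp only [pos] at c1 c2
        omega
      · rw [hq] at c1 c2 n1 n2 n3
        simp only [Sum.inr.injEq, ne_eq, Fin.ext_iff] at n1 n2 n3
        simp only [pos] at c1 c2
        exact ih (q - p - 1) (by omega) p q (by omega) hq
  obtain ⟨i, j, hij⟩ := h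
  have hne : (i : ℕ) ≠ j := fun e => a.join_ne (Sum.inr i) (by rw [hij, Fin.ext e])
  rcases Nat.lt_or_gt_of_ne hne with h | h
  · exact key (j - i - 1) i j (by omega) hij
  · exact key (i - j - 1) j i (by omega) (by rw [← hij, a.join_join])

/-- In a diagram without strands between right points, all strands run from left to right, in the
same order on both lines. -/
theorem eq_one_of_no_cap {m : ℕ} (a : Diagram m) (h : ¬ ∃ i j, a.join (Sum.inr i) = Sum.inr j) :
    a = Diagram.one m := by
  have h1 : ∀ i, ∃ j, a.join (Sum.inr i) = Sum.inl j := by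
    intro i
    rcases hq : a.join (Sum.inr i) with q | q
    · exact ⟨q, rfl⟩
    · exact absurd ⟨i, q, hq⟩ h
  choose σ hσ using h1
  have hσ' : ∀ i, a.join (Sum.inl (σ i)) = Sum.inr i := fun i => by rw [← hσ, a.join_join]
  have hmono : StrictMono σ := by
    intro i j hij
    by_contra hlt
    have hne : σ i ≠ σ j := fun e => hij.ne (by
      have := hσ' i
      rw [e, hσ' j] at this
      exact (Sum.inr_injective this).symm)
    have := a.noncrossing (Sum.inl (σ j)) (Sum.inl (σ i))
    rw [hσ', hσ'] at this
    simp only [pos] at this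
    rw [Ne, Fin.ext_iff] at hne
    rw [Fin.lt_def] at hij hlt
    omega
  have hid : σ = id := by
    refine (StrictMono.range_inj hmono strictMono_id).1 ?_
    rw [Set.range_id, (Finite.injective_iff_surjective.1 hmono.injective).range_eq]
  apply Diagram.join_injective
  funext p
  rcases p with i | i
  · have := hσ' i
    rwa [hid] at this
  · rw [hσ, hid]
    rfl

section One

variable {m k : ℕ}

theorem orb_one_inr (v : LinkState m k) (i : Fin m) :
    orb (Diagram.one m).join v.ext (Sum.inr i) = orb (Diagram.one m).join v.ext (Sum.inl i) :=
  orb_left (Diagram.one m).join v.ext (Sum.inl i)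

theorem orb_one_iff (v : LinkState m k) (i j : Fin m) :
    orb (Diagram.one m).join v.ext (Sum.inl i) = orb (Diagram.one m).join v.ext (Sum.inl j) ↔
      i = j ∨ v.join i = j := by
  constructor
  · intro h
    have := eq_of_orb_eq (Sum.elim (fun i => s(i, v.join i)) (fun i => s(i, v.join i))) ?_ ?_ h
    · simp only [Sum.elim_inl, Sym2.eq_iff] at this
      grind
    · rintro (i | i) <;> rfl
    · rintro (i | i)
      · rfl
      · simp [v.join_join, Sym2.eq_swap]
  · rintro (rfl | rfl)
    · rfl
    · rw [← orb_one_inr, ← orb_one_inr]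
      exact (orb_right (Diagram.one m).join v.ext (Sum.inr i)).symm

theorem actsTo_one_iff (v w : LinkState m k) : ActsTo (Diagram.one m) v w ↔ w = v := by
  have h : ActsTo (Diagram.one m) v v := by
    rw [actsTo_iff]
    refine ⟨fun i j hi hj hij => ?_, fun i j hij => ?_⟩
    · rw [orb_one_inr, orb_one_inr, orb_one_iff] at hij
      rcases hij with h | h
      · exact h
      · exact hi.symm.trans h
    · rw [orb_one_iff]
      simp [hij]
  exact ⟨fun h' => h'.unique h, fun e => e ▸ h⟩

theorem actLoops_one (v : LinkState m k) : actLoops (Diagram.one m) v = 0 := by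
  rw [actLoops_eq, numLoops, Nat.card_eq_zero]
  refine Or.inl ⟨?_⟩
  rintro ⟨⟨i | i⟩, hC⟩
  · exact hC (Sum.inl i) rfl rfl
  · exact hC (Sum.inl i) rfl (orb_one_inr v i).symm

theorem trace_actMatrix_one (χ : ℂ) :
    (actMatrix χ k (Diagram.one m)).trace = Nat.card (LinkState m k) := by
  simp [Matrix.trace, actMatrix, actsTo_one_iff, actLoops_one]

theorem closeLoops_one : closeLoops (Diagram.one m) = m := by
  let e : Orb (Diagram.one m).join Sum.swap ≃ Fin m :=
    { toFun := Quot.lift (Sum.elim id id) (by rintro (i | i) _ (rfl | rfl) <;> rfl)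
      invFun := fun i => orb _ _ (Sum.inl i)
      left_inv := by
        rintro ⟨i | i⟩
        · rfl
        · exact orb_right (Diagram.one m).join Sum.swap (Sum.inr i)
      right_inv := fun i => rfl }
  exact (Nat.card_congr e).trans (by simp)

end One

theorem isEmpty_linkState {m k : ℕ} (h : m < 2 * k) : IsEmpty (LinkState m k) := by
  refine ⟨fun v => ?_⟩
  have h1 := v.card_defects
  have h2 := Nat.card_le_card_of_injective (fun i : {i // v.join i = i} => i.1)
    Subtype.val_injective
  rw [Nat.card_fin] at h2
  omega

/-- The reduction from `2 n + 2` to `2 n` points for a weighted sum of traces. The last module has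
no counterpart on `2 n` points. -/
theorem IsInsertion.sum_trace_actMatrix {n l : ℕ} {hl : l ≤ 2 * n} {b : Diagram (2 * n)}
    {c : Diagram (2 * n + 2)} (H : IsInsertion l hl b c) (χ : ℂ) (d : ℕ → ℂ) :
    ∑ k ∈ Finset.range (n + 2), d k * (actMatrix χ k c).trace =
      χ * ∑ k ∈ Finset.range (n + 1), d k * (actMatrix χ k b).trace := by
  have he := isEmpty_linkState (m := 2 * n) (k := n + 1) (by omega)
  have h0 : (actMatrix χ (n + 1) b).trace = 0 := by
    rw [Matrix.trace, Finset.univ_eq_empty, Finset.sum_empty]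
  simp only [H.trace_actMatrix, Finset.sum_range_succ _ (n + 1), h0, mul_zero, add_zero,
    Finset.mul_sum]
  exact Finset.sum_congr rfl fun k _ => by ring

/-- The sum of the traces over the standard modules agrees with the diagrammatic trace for all
diagrams as soon as it does so for the units. Indeed each diagram other than the unit has a strand
between neighbouring right points, and then it can be reduced to a diagram with fewer points. -/
theorem pow_closeLoops_eq_sum {χ : ℂ} (hχ : χ ≠ 0) {d : ℕ → ℂ}
    (hd : ∀ n, ∑ k ∈ Finset.range (n + 1), d k * Nat.card (LinkState (2 * n) k) = χ ^ (2 * n))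
    (n : ℕ) (a : Diagram (2 * n)) :
    χ ^ closeLoops a = ∑ k ∈ Finset.range (n + 1), d k * (actMatrix χ k a).trace := by
  induction n with
  | zero =>
    have ha : a = Diagram.one 0 := eq_one_of_no_cap a (by rintro ⟨i, -⟩; exact i.elim0)
    subst ha
    have := hd 0
    simp only [trace_actMatrix_one, closeLoops_one]
    exact this.symm
  | succ n ih =>
    by_cases h : ∃ i j, a.join (Sum.inr i) = Sum.inr j
    swap
    · have ha : a = Diagram.one _ := eq_one_of_no_cap a h
      subst ha
      simp only [trace_actMatrix_one, closeLoops_one]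
      exact (hd (n + 1)).symm
    obtain ⟨i, j, hij, hcap⟩ := exists_neighbouring_cap a h
    have hi : (i : ℕ) ≤ 2 * n := by omega
    have hins : ∀ {b : Diagram (2 * n)} {c : Diagram (2 * n + 2)},
        IsInsertion (i : ℕ) hi b c →
        χ ^ closeLoops c = ∑ k ∈ Finset.range (n + 2), d k * (actMatrix χ k c).trace :=
      fun {b c} H => by rw [H.sum_trace_actMatrix, H.closeLoops_eq, pow_succ', ih b]
    by_cases hl : a.join (Sum.inl i) = Sum.inl j
    · obtain ⟨b, H⟩ := exists_isInsertion_of_join i hi rfl hij hl hcap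
      exact hins H
    · have hr : (a.splice hij).join (Sum.inr i) = Sum.inr j := by
        have hl' : a.join (Sum.inl j) ≠ Sum.inl i := fun e => hl (by rw [← e, a.join_join])
        simp [Diagram.splice, splice, hcap]
      obtain ⟨b, H⟩ := exists_isInsertion_of_join (b := a.splice hij) i hi rfl hij splice_left hr
      have h1 := hins H
      simp only [closeLoops_splice hij hcap hl, trace_actMatrix_splice χ _ hij hcap hl] at h1
      refine mul_left_cancel₀ hχ ?_
      rw [← pow_succ', h1, Finset.mul_sum]
      exact Finset.sum_congr rfl fun k _ => by ring

/-! ### The number of link states -/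

section

/-- The planar involutions of `m` points: the link states with any number of defects. -/
def PlanarInvolution (m : ℕ) : Type :=
  {w : Fin m → Fin m // Function.Involutive w ∧ IsPlanar (fun i : Fin m => (i : ℕ)) w}

noncomputable instance (m : ℕ) : Fintype (PlanarInvolution m) :=
  Fintype.ofInjective (fun w => w.1) Subtype.val_injective

/-- The number of fixed points. -/
def numFixed {m : ℕ} (w : Fin m → Fin m) : ℕ := ∑ i, if w i = i then 1 else 0

theorem natCard_fixed {m : ℕ} (w : Fin m → Fin m) : Nat.card {i // w i = i} = numFixed w := by
  rw [Nat.card_eq_fintype_card, Fintype.card_subtype, Finset.card_filter, numFixed]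

variable {m : ℕ}

/-- The involution with a further defect on the far side of all points. -/
def addDefect (u : Fin m → Fin m) : Fin (m + 1) → Fin (m + 1) :=
  Fin.lastCases (Fin.last m) fun p => (u p).castSucc

/-- The involution in which the defect `D` has been joined to a new last point. -/
def closeDefect (u : Fin m → Fin m) (D : Fin m) : Fin (m + 1) → Fin (m + 1) :=
  Fin.lastCases D.castSucc fun p => if p = D then Fin.last m else (u p).castSucc

@[simp] theorem addDefect_last (u : Fin m → Fin m) : addDefect u (Fin.last m) = Fin.last m := by
  simp [addDefect]

@[simp] theorem addDefect_castSucc (u : Fin m → Fin m) (p : Fin m) :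
    addDefect u p.castSucc = (u p).castSucc := by
  simp [addDefect]

@[simp] theorem closeDefect_last (u : Fin m → Fin m) (D : Fin m) :
    closeDefect u D (Fin.last m) = D.castSucc := by
  simp [closeDefect]

@[simp] theorem closeDefect_castSucc (u : Fin m → Fin m) (D p : Fin m) :
    closeDefect u D p.castSucc = if p = D then Fin.last m else (u p).castSucc := by
  simp [closeDefect]

theorem numFixed_addDefect (u : Fin m → Fin m) : numFixed (addDefect u) = numFixed u + 1 := by
  simp only [numFixed, Fin.sum_univ_castSucc, addDefect_castSucc, addDefect_last,
    Fin.castSucc_inj, if_true]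

theorem numFixed_closeDefect {u : Fin m → Fin m} {D : Fin m} (hD : u D = D) :
    numFixed (closeDefect u D) + 1 = numFixed u := by
  have h1 : (∑ p : Fin m, if p = D then 1 else 0) = 1 := by simp
  have h2 : numFixed (closeDefect u D) + (∑ p : Fin m, if p = D then 1 else 0) = numFixed u := by
    rw [numFixed, numFixed, Fin.sum_univ_castSucc, closeDefect_last,
      if_neg (Fin.castSucc_lt_last D).ne, add_zero, ← Finset.sum_add_distrib]
    refine Finset.sum_congr rfl fun p _ => ?_
    by_cases hp : p = D
    · subst hp
      simp [hD, (Fin.castSucc_lt_last p).ne']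
    · simp [hp]
  rwa [h1] at h2

theorem addDefect_prop {u : Fin m → Fin m} (hu : Function.Involutive u)
    (H : IsPlanar (fun i : Fin m => (i : ℕ)) u) :
    Function.Involutive (addDefect u) ∧
      IsPlanar (fun i : Fin (m + 1) => (i : ℕ)) (addDefect u) := by
  refine ⟨fun p => ?_, fun p q => ?_, fun p q hq => ?_⟩
  · induction p using Fin.lastCases <;> simp [hu _]
  · induction p using Fin.lastCases with
    | last => simp only [Fin.val_last]; omega
    | cast p =>
      induction q using Fin.lastCases with
      | last => simp only [addDefect_castSucc, Fin.val_last, Fin.val_castSucc]; omega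
      | cast q => simpa using H.1 p q
  · induction p using Fin.lastCases with
    | last => simp only [Fin.val_last]; omega
    | cast p =>
      induction q using Fin.lastCases with
      | last => simp only [addDefect_castSucc, Fin.val_last, Fin.val_castSucc]; omega
      | cast q => simpa using H.2 p q (by simpa using hq)

theorem closeDefect_prop {u : Fin m → Fin m} (hu : Function.Involutive u)
    (H : IsPlanar (fun i : Fin m => (i : ℕ)) u) {D : Fin m} (hD : u D = D)
    (hmax : ∀ p, u p = p → p ≤ D) :
    Function.Involutive (closeDefect u D) ∧
      IsPlanar (fun i : Fin (m + 1) => (i : ℕ)) (closeDefect u D) := by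
  refine ⟨fun p => ?_, fun p q => ?_, fun p q hq => ?_⟩
  · induction p using Fin.lastCases with
    | last => simp
    | cast p =>
      by_cases hp : p = D
      · simp [hp]
      · have : u p ≠ D := fun e => hp (by rw [← hu p, e, hD])
        simp [hp, this, hu p]
  · induction p using Fin.lastCases with
    | last => simp only [Fin.val_last]; omega
    | cast p =>
      induction q using Fin.lastCases with
      | last => simp only [Fin.val_last, Fin.val_castSucc]; omega
      | cast q =>
        have h1 := H.1 p q
        have h2 := H.2 p q
        by_cases hp : p = D <;> by_cases hq : q = D <;>
          simp only [closeDefect_castSucc, hp, hq, if_true, if_false, Fin.val_last,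
            Fin.val_castSucc]
        · omega
        · omega
        · rw [hq] at h2
          have := h2 hD
          beta_reduce at this
          omega
        · exact h1
  · induction q using Fin.lastCases with
    | last => simp only [Fin.val_last]; omega
    | cast q =>
      have hqD : q ≠ D := by
        rintro rfl
        simp at hq
        exact (Fin.castSucc_lt_last q).ne' hq
      have hq' : u q = q := by simpa [hqD] using hq
      have hlt := hmax q hq'
      induction p using Fin.lastCases with
      | last => simp only [Fin.val_last, Fin.val_castSucc]; omega
      | cast p =>
        by_cases hp : p = D
        · subst hp
          simp only [Fin.val_castSucc]
          rw [Fin.le_def] at hlt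
          omega
        · simpa [hp] using H.2 p q hq'

/-- A planar involution arises by adding a defect or by closing the last defect, according to
whether its last point is a defect. -/
theorem exists_of_last {w : Fin (m + 1) → Fin (m + 1)} (hw : Function.Involutive w)
    (H : IsPlanar (fun i : Fin (m + 1) => (i : ℕ)) w) :
    ∃ u : Fin m → Fin m, Function.Involutive u ∧ IsPlanar (fun i : Fin m => (i : ℕ)) u ∧
      (addDefect u = w ∨
        ∃ D, u D = D ∧ (∀ p, u p = p → p ≤ D) ∧ closeDefect u D = w) := by
  by_cases hl : w (Fin.last m) = Fin.last m
  · have h1 : ∀ p : Fin m, ∃ q : Fin m, w p.castSucc = q.castSucc := by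
      intro p
      rcases Fin.eq_castSucc_or_eq_last (w p.castSucc) with ⟨q, hq⟩ | hq
      · exact ⟨q, hq⟩
      · have := hw p.castSucc
        rw [hq, hl] at this
        exact absurd this (Fin.castSucc_lt_last p).ne'
    choose u hu using h1
    refine ⟨u, fun p => ?_, ⟨fun p q => ?_, fun p q hq => ?_⟩, Or.inl ?_⟩
    · have := hw p.castSucc
      rw [hu, hu] at this
      exact Fin.castSucc_injective _ this
    · simpa [hu] using H.1 p.castSucc q.castSucc
    · simpa [hu] using H.2 p.castSucc q.castSucc (by rw [hu, hq])
    · funext p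
      induction p using Fin.lastCases with
      | last => simp [hl]
      | cast p => simp [hu]
  · obtain ⟨D, hD⟩ := (Fin.eq_castSucc_or_eq_last (w (Fin.last m))).resolve_right hl
    have hD' : w D.castSucc = Fin.last m := by rw [← hD, hw]
    have h1 : ∀ p : Fin m, ∃ q : Fin m,
        (p = D → q = D) ∧ (p ≠ D → w p.castSucc = q.castSucc) := by
      intro p
      by_cases hp : p = D
      · exact ⟨D, fun _ => rfl, fun h => absurd hp h⟩
      rcases Fin.eq_castSucc_or_eq_last (w p.castSucc) with ⟨q, hq⟩ | hq
      · exact ⟨q, fun h => absurd h hp, fun _ => hq⟩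
      · have := hw p.castSucc
        rw [hq, hD] at this
        exact absurd (Fin.castSucc_injective _ this).symm hp
    choose u hu1 hu using h1
    have huD : u D = D := hu1 D rfl
    refine ⟨u, fun p => ?_, ⟨fun p q => ?_, fun p q hq => ?_⟩, Or.inr ⟨D, huD, fun p hp => ?_, ?_⟩⟩
    · by_cases hp : p = D
      · rw [hp, huD, huD]
      have hup : u p ≠ D := fun e => by
        have h2 := hw p.castSucc
        rw [hu p hp, e, hD'] at h2
        exact (Fin.castSucc_lt_last p).ne' h2
      have h2 := hw p.castSucc
      rw [hu p hp, hu _ hup] at h2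
      exact Fin.castSucc_injective _ h2
    · by_cases hp : p = D
      · subst hp
        rw [huD]
        omega
      by_cases hq : q = D
      · subst hq
        rw [huD]
        omega
      have := H.1 p.castSucc q.castSucc
      rw [hu p hp, hu q hq] at this
      simpa using this
    · by_cases hp : p = D
      · subst hp
        rw [huD]
        omega
      by_cases hqD : q = D
      · subst hqD
        have := H.1 p.castSucc q.castSucc
        rw [hu p hp, hD'] at this
        simp only [Fin.val_castSucc, Fin.val_last] at this
        beta_reduce
        omega
      have := H.2 p.castSucc q.castSucc (by rw [hu q hqD, hq])
      rw [hu p hp] at this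
      simpa using this
    · by_contra hlt
      have hpD : p ≠ D := fun e => hlt e.le
      have := H.2 D.castSucc p.castSucc (by rw [hu p hpD, hp])
      rw [hD'] at this
      simp only [Fin.val_castSucc, Fin.val_last] at this
      rw [Fin.le_def] at hlt
      omega
    · funext p
      induction p using Fin.lastCases with
      | last => simp [hD]
      | cast p =>
        by_cases hp : p = D
        · simp [hp, hD']
        · simp [hp, hu p hp]

theorem exists_last_defect {u : Fin m → Fin m} (h : numFixed u ≠ 0) :
    ∃ D, u D = D ∧ ∀ p, u p = p → p ≤ D := by
  classical
  have hne : (Finset.univ.filter fun p => u p = p).Nonempty := by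
    by_contra h0
    rw [Finset.not_nonempty_iff_eq_empty] at h0
    exact h (by rw [numFixed, ← Finset.card_filter, h0, Finset.card_empty])
  refine ⟨Finset.max' _ hne, ?_, fun p hp => Finset.le_max' _ _ (by simpa using hp)⟩
  simpa using Finset.max'_mem _ hne

/-- The planar involutions of `m` points, weighted with numbers that satisfy the recursion of the
quantum integers, have total weight `χ ^ m`: each of them extends to `m + 1` points by a further
defect or by closing its last defect. -/
theorem sum_numFixed {χ : ℂ} {U : ℕ → ℂ} (h0 : U 0 = 1) (h1 : U 1 = χ)
    (h2 : ∀ l, U (l + 2) + U l = χ * U (l + 1)) (m : ℕ) :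
    ∑ w : PlanarInvolution m, U (numFixed w.1) = χ ^ m := by
  classical
  induction m with
  | zero =>
    have : Unique (PlanarInvolution 0) :=
      { default := ⟨id, fun p => p.elim0, fun p => p.elim0, fun p => p.elim0⟩
        uniq := fun w => Subtype.ext (funext fun p => p.elim0) }
    rw [Fintype.sum_unique]
    simp [numFixed, h0]
  | succ m ih =>
    choose D hD hmax using fun u : {u : PlanarInvolution m // numFixed u.1 ≠ 0} =>
      exists_last_defect u.2
    let Φ : PlanarInvolution m ⊕ {u : PlanarInvolution m // numFixed u.1 ≠ 0} →
        PlanarInvolution (m + 1) := Sum.elim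
      (fun u => ⟨addDefect u.1, addDefect_prop u.2.1 u.2.2⟩)
      (fun u => ⟨closeDefect u.1.1 (D u),
        closeDefect_prop u.1.2.1 u.1.2.2 (hD u) (hmax u)⟩)
    have hΦ : Function.Bijective Φ := by
      constructor
      · rintro (u | u) (v | v) h
        · have h : addDefect u.1 = addDefect v.1 := congrArg Subtype.val h
          refine congrArg Sum.inl (Subtype.ext (funext fun p => ?_))
          simpa using congrFun h p.castSucc
        · have h : addDefect u.1 = closeDefect v.1.1 (D v) := congrArg Subtype.val h
          exact absurd (by simpa using congrFun h (Fin.last m)) (Fin.castSucc_lt_last (D v)).ne'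
        · have h : closeDefect u.1.1 (D u) = addDefect v.1 := congrArg Subtype.val h
          exact absurd (by simpa using congrFun h (Fin.last m)) (Fin.castSucc_lt_last (D u)).ne
        · have h : closeDefect u.1.1 (D u) = closeDefect v.1.1 (D v) := congrArg Subtype.val h
          have hDD : D u = D v := by simpa using congrFun h (Fin.last m)
          refine congrArg Sum.inr (Subtype.ext (Subtype.ext (funext fun p => ?_)))
          by_cases hp : p = D u
          · rw [hp, hD, hDD, hD]
          · have := congrFun h p.castSucc
            simpa [hp, ← hDD] using this
      · rintro ⟨w, hw, H⟩
        obtain ⟨u, hu, hup, rfl | ⟨E, hE, hEmax, rfl⟩⟩ := exists_of_last hw H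
        · exact ⟨Sum.inl ⟨u, hu, hup⟩, rfl⟩
        · have hne : numFixed u ≠ 0 := by rw [← numFixed_closeDefect hE]; omega
          refine ⟨Sum.inr ⟨⟨u, hu, hup⟩, hne⟩, Subtype.ext ?_⟩
          have : D ⟨⟨u, hu, hup⟩, hne⟩ = E :=
            le_antisymm (hEmax _ (hD ⟨⟨u, hu, hup⟩, hne⟩)) (hmax ⟨⟨u, hu, hup⟩, hne⟩ E hE)
          change closeDefect u (D ⟨⟨u, hu, hup⟩, hne⟩) = closeDefect u E
          rw [this]
    rw [← hΦ.sum_comp, Fintype.sum_sum_type]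
    have e1 : ∀ u, numFixed (Φ (Sum.inl u)).1 = numFixed u.1 + 1 := fun u => numFixed_addDefect _
    have e2 : ∀ u, numFixed (Φ (Sum.inr u)).1 = numFixed u.1.1 - 1 := fun u => by
      have := numFixed_closeDefect (hD u)
      change numFixed (closeDefect u.1.1 (D u)) = _
      omega
    simp only [e1, e2]
    rw [← Finset.sum_subtype (Finset.univ.filter fun u : PlanarInvolution m => numFixed u.1 ≠ 0)
      (by simp) (fun u => U (numFixed u.1 - 1)), Finset.sum_filter, ← Finset.sum_add_distrib,
      pow_succ', ← ih, Finset.mul_sum]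
    refine Finset.sum_congr rfl fun u _ => ?_
    rcases Nat.eq_zero_or_eq_succ_pred (numFixed u.1) with h | h
    · simp [h, h0, h1]
    · rw [h, if_pos (Nat.succ_ne_zero _), ← h2]
      rfl

end

/-- A planar involution of an even number of points has an even number of fixed points. -/
theorem even_numFixed {n : ℕ} {w : Fin (2 * n) → Fin (2 * n)} (hw : Function.Involutive w) :
    Even (numFixed w) := by
  have h1 : (∑ i, if w i = i then (0 : ZMod 2) else 1) = 0 := by
    refine Finset.sum_involution (fun i _ => w i) ?_ ?_ (fun i _ => Finset.mem_univ _)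
      (fun i _ => hw i)
    · intro i _
      have : w (w i) = w i ↔ w i = i := hw.injective.eq_iff
      simp only [this]
      exact CharTwo.add_self_eq_zero _
    · intro i _ hi he
      exact hi (if_pos he)
  have h2 : (numFixed w : ZMod 2) + (∑ i, if w i = i then (0 : ZMod 2) else 1) = 0 := by
    rw [numFixed, Nat.cast_sum, ← Finset.sum_add_distrib]
    have : ∀ i, (((if w i = i then 1 else 0 : ℕ) : ZMod 2) +
        if w i = i then (0 : ZMod 2) else 1) = 1 := fun i => by split_ifs <;> simp
    simp only [this, Finset.sum_const, Finset.card_univ, Fintype.card_fin, nsmul_eq_mul,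
      Nat.cast_mul, Nat.cast_ofNat, mul_one]
    rw [show (2 : ZMod 2) = 0 from rfl, zero_mul]
  rw [h1, add_zero] at h2
  exact (ZMod.natCast_eq_zero_iff_even).1 h2

theorem numFixed_le {m : ℕ} (w : Fin m → Fin m) : numFixed w ≤ m := by
  refine (Finset.sum_le_card_nsmul _ _ 1 fun i _ => ?_).trans (by simp)
  split_ifs <;> simp

theorem sum_card_linkState {χ : ℂ} {U : ℕ → ℂ} (h0 : U 0 = 1) (h1 : U 1 = χ)
    (h2 : ∀ l, U (l + 2) + U l = χ * U (l + 1)) (n : ℕ) :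
    ∑ k ∈ Finset.range (n + 1), U (2 * k) * Nat.card (LinkState (2 * n) k) = χ ^ (2 * n) := by
  classical
  rw [← sum_numFixed h0 h1 h2, ← Finset.sum_fiberwise_of_maps_to
    (g := fun w : PlanarInvolution (2 * n) => numFixed w.1 / 2) (t := Finset.range (n + 1))]
  · refine Finset.sum_congr rfl fun k _ => ?_
    have hcard : Nat.card (LinkState (2 * n) k) =
        (Finset.univ.filter fun w : PlanarInvolution (2 * n) => numFixed w.1 / 2 = k).card := by
      rw [← Fintype.card_subtype, ← Nat.card_eq_fintype_card]
      refine Nat.card_congr (Equiv.ofBijective (fun v => ⟨⟨v.join, v.join_join, v.isPlanar⟩, ?_⟩)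
        ⟨?_, ?_⟩)
      · rw [← natCard_fixed, v.card_defects]
        omega
      · intro v v' h
        exact LinkState.join_injective _ _ (congrArg (fun w => w.1.1) h)
      · rintro ⟨⟨w, hw, H⟩, hk⟩
        have he := even_numFixed hw
        refine ⟨⟨w, hw, H.1, fun i j => H.2 i j, ?_⟩, rfl⟩
        rw [natCard_fixed, ← hk]
        exact (Nat.two_mul_div_two_of_even he).symm
    rw [Finset.sum_congr rfl (g := fun _ => U (2 * k)), Finset.sum_const, hcard, nsmul_eq_mul,
      mul_comm]
    intro w hw
    have hk := (Finset.mem_filter.1 hw).2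
    rw [← hk, Nat.two_mul_div_two_of_even (even_numFixed w.2.1)]
  · intro w _
    have := numFixed_le w.1
    rw [Finset.mem_range]
    omega

/-! ### Chebyshev polynomials and quantum integers -/

/-- The multiplicity polynomials: the Chebyshev polynomials `S_{2 k}`, where `S_n (q + q⁻¹)` is the
quantum integer `[n + 1]_q`. -/
noncomputable def multPoly (k : ℕ) : Polynomial ℤ := Polynomial.Chebyshev.S ℤ (2 * k : ℕ)

/-- The Chebyshev polynomial `S_l` at `χ`. -/
noncomputable def chebyshevAt (χ : ℂ) (l : ℕ) : ℂ := (Polynomial.Chebyshev.S ℂ l).eval χ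

theorem aeval_multPoly (χ : ℂ) (k : ℕ) :
    Polynomial.aeval χ (multPoly k) = chebyshevAt χ (2 * k) := by
  rw [multPoly, Polynomial.Chebyshev.aeval_S, chebyshevAt]

theorem chebyshevAt_zero (χ : ℂ) : chebyshevAt χ 0 = 1 := by simp [chebyshevAt]

theorem chebyshevAt_one (χ : ℂ) : chebyshevAt χ 1 = χ := by simp [chebyshevAt]

theorem chebyshevAt_add_two (χ : ℂ) (l : ℕ) :
    chebyshevAt χ (l + 2) + chebyshevAt χ l = χ * chebyshevAt χ (l + 1) := by
  simp [chebyshevAt]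

theorem multPoly_values : multPoly 0 = 1 ∧ multPoly 1 = Polynomial.X ^ 2 - 1 ∧
    multPoly 2 = Polynomial.X ^ 4 - 3 * Polynomial.X ^ 2 + 1 ∧
    multPoly 3 = Polynomial.X ^ 6 - 5 * Polynomial.X ^ 4 + 6 * Polynomial.X ^ 2 - 1 := by
  have h2 := Polynomial.Chebyshev.S_two ℤ
  have h1 := Polynomial.Chebyshev.S_one ℤ
  have h3 : Polynomial.Chebyshev.S ℤ 3 = _ := Polynomial.Chebyshev.S_add_two ℤ 1
  have h4 : Polynomial.Chebyshev.S ℤ 4 = _ := Polynomial.Chebyshev.S_add_two ℤ 2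
  have h5 : Polynomial.Chebyshev.S ℤ 5 = _ := Polynomial.Chebyshev.S_add_two ℤ 3
  have h6 : Polynomial.Chebyshev.S ℤ 6 = _ := Polynomial.Chebyshev.S_add_two ℤ 4
  norm_num at h3 h4 h5 h6
  rw [h2] at h3
  rw [h2, h3] at h4
  rw [h3, h4] at h5
  rw [h4, h5] at h6
  refine ⟨by simp [multPoly], by simp [multPoly, h2], ?_, ?_⟩
  · simp only [multPoly]
    norm_num
    rw [h4]
    ring
  · simp only [multPoly]
    norm_num
    rw [h6]
    ring

/-- `S_l (q + q⁻¹) = (q ^ (l + 1) - q⁻¹ ^ (l + 1)) / (q - q⁻¹)`, without the division, so that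
`q = q⁻¹` is allowed. -/
theorem chebyshevAt_mul_sub {q : ℂ} (hq : q ≠ 0) (l : ℕ) :
    chebyshevAt (q + q⁻¹) l * (q - q⁻¹) = q ^ (l + 1) - q⁻¹ ^ (l + 1) := by
  have hqq : q * q⁻¹ = 1 := mul_inv_cancel₀ hq
  induction l using Nat.twoStepInduction with
  | zero => simp [chebyshevAt_zero]
  | one => rw [chebyshevAt_one]; ring
  | more l h0 h1 =>
    linear_combination (chebyshevAt_add_two (q + q⁻¹) l) * (q - q⁻¹) + (q + q⁻¹) * h1 - h0 +
      (q ^ (l + 1) - q⁻¹ ^ (l + 1)) * hqq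

theorem qNumber_succ {q : ℂ} (hq : q ≠ 0) (n : ℕ) :
    qNumber q (n + 1) = q * qNumber q n + q ^ (-(n : ℤ)) := by
  rw [qNumber, qNumber, Finset.sum_range_succ, Finset.mul_sum]
  congr 1
  · refine Finset.sum_congr rfl fun j _ => ?_
    rw [← zpow_one_add₀ hq]
    congr 1
    push_cast
    ring
  · congr 1
    push_cast
    ring

theorem qNumber_eq_chebyshevAt {q : ℂ} (hq : q ≠ 0) (l : ℕ) :
    qNumber q (l + 1) = chebyshevAt (q + q⁻¹) l := by
  have h0 : qNumber q 1 = 1 := by simp [qNumber]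
  induction l using Nat.twoStepInduction with
  | zero => rw [h0, chebyshevAt_zero]
  | one =>
    rw [qNumber_succ hq, h0, chebyshevAt_one]
    simp
  | more l e0 e1 =>
    have e2 := chebyshevAt_add_two (q + q⁻¹) l
    have e3 := qNumber_succ hq (l + 1 + 1)
    have e4 := qNumber_succ hq (l + 1)
    have e5 : q⁻¹ * q ^ (-((l + 1 : ℕ) : ℤ)) = q ^ (-((l + 1 + 1 : ℕ) : ℤ)) := by
      rw [← zpow_neg_one, ← zpow_add₀ hq]
      congr 1
      push_cast
      ring
    have hqq : q⁻¹ * q = 1 := inv_mul_cancel₀ hq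
    rw [← e0, ← e1] at e2
    linear_combination e3 - e2 - q⁻¹ * e4 - e5 - hqq * qNumber q (l + 1)

theorem sum_range_two_mul (f : ℕ → ℂ) (K : ℕ) :
    ∑ j ∈ Finset.range (2 * K), f j = ∑ j ∈ Finset.range K, (f (2 * j) + f (2 * j + 1)) := by
  induction K with
  | zero => simp
  | succ K ih =>
    rw [Finset.sum_range_succ, ← ih, mul_add, mul_one, Finset.sum_range_succ,
      Finset.sum_range_succ, add_assoc]

/-- The odd part of the binomial expansion. -/
theorem add_pow_sub_sub_pow (x s : ℂ) (k : ℕ) :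
    (x + s) ^ (2 * k + 1) - (x - s) ^ (2 * k + 1) =
      2 * s * ∑ j ∈ Finset.range (k + 1),
        ((2 * k + 1).choose (2 * j + 1) : ℂ) * x ^ (2 * (k - j)) * (s ^ 2) ^ j := by
  rw [sub_eq_add_neg x s, add_comm x s, add_comm x (-s), add_pow, add_pow,
    ← Finset.sum_sub_distrib, show 2 * k + 1 + 1 = 2 * (k + 1) by ring, sum_range_two_mul,
    Finset.mul_sum]
  refine Finset.sum_congr rfl fun j hj => ?_
  have hj : j ≤ k := Nat.lt_succ_iff.1 (Finset.mem_range.1 hj)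
  have h1 : 2 * k + 1 - (2 * j + 1) = 2 * (k - j) := by omega
  have h2 : (-s) ^ (2 * j) = (s ^ 2) ^ j := by rw [pow_mul, neg_sq]
  have h3 : s ^ (2 * j) = (s ^ 2) ^ j := pow_mul s 2 j
  rw [h1, pow_succ s, pow_succ (-s), h2, h3]
  ring

/-- The explicit formula for `S_{2 k}`: with `χ = q + q⁻¹` and `s = q - q⁻¹` it is the odd part of
the expansion of `(2 q) ^ (2 k + 1) = (χ + s) ^ (2 k + 1)`, divided by `s`. -/
theorem four_pow_mul_multPoly (k : ℕ) : 4 ^ k * multPoly k =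
    ∑ n ∈ Finset.Icc 1 (k + 1),
      ((Nat.choose (2 * k + 1) (2 * n - 1) : ℕ) : Polynomial ℤ) *
        Polynomial.X ^ (2 * (k + 1 - n)) * (Polynomial.X ^ 2 - 4) ^ (n - 1) := by
  apply Polynomial.map_injective (Int.castRingHom ℂ) Int.cast_injective
  refine Polynomial.eq_of_infinite_eval_eq _ _ (Set.Infinite.mono ?_
    (Set.Finite.infinite_compl (Set.toFinite ({2, -2} : Set ℂ))))
  intro χ hχ
  have hχ4 : χ ^ 2 - 4 ≠ 0 := by
    intro h
    have h2 : (χ - 2) * (χ + 2) = 0 := by linear_combination h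
    rcases mul_eq_zero.1 h2 with h3 | h3
    · exact hχ (Or.inl (sub_eq_zero.1 h3))
    · exact hχ (Or.inr (eq_neg_of_add_eq_zero_left h3))
  obtain ⟨s, hs⟩ := IsAlgClosed.exists_pow_nat_eq (χ ^ 2 - 4) (n := 2) two_pos
  have hs0 : s ≠ 0 := by
    rintro rfl
    exact hχ4 (by rw [← hs]; simp)
  set q : ℂ := (χ + s) / 2 with hq
  have hqm : q * ((χ - s) / 2) = 1 := by rw [hq]; linear_combination -hs / 4
  have hq0 : q ≠ 0 := left_ne_zero_of_mul_eq_one hqm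
  have hqi : q⁻¹ = (χ - s) / 2 := inv_eq_of_mul_eq_one_right hqm
  have e1 := chebyshevAt_mul_sub hq0 (2 * k)
  have e2 : q + q⁻¹ = χ := by rw [hqi, hq]; ring
  have e3 : q - q⁻¹ = s := by rw [hqi, hq]; ring
  have e4 := add_pow_sub_sub_pow χ s k
  rw [e2, e3, hqi, hq, div_pow, div_pow] at e1
  have hicc : Finset.Icc 1 (k + 1) = Finset.Ico (0 + 1) (k + 1 + 1) := by
    ext n
    simp only [Finset.mem_Icc, Finset.mem_Ico]
    omega
  have hP : ((multPoly k).map (Int.castRingHom ℂ)).eval χ = chebyshevAt χ (2 * k) := by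
    rw [multPoly, Polynomial.Chebyshev.map_S, chebyshevAt]
  simp only [Set.mem_ofPred_eq, Polynomial.map_mul, Polynomial.map_pow, Polynomial.eval_mul,
    Polynomial.eval_pow, hP, Polynomial.map_sum, Polynomial.eval_finsetSum,
    Polynomial.map_natCast, Polynomial.map_ofNat, Polynomial.eval_ofNat, Polynomial.map_sub,
    Polynomial.map_X, Polynomial.eval_sub, Polynomial.eval_X, Polynomial.eval_natCast]
  rw [hicc, ← Finset.sum_Ico_add', ← Finset.range_eq_Ico]
  have e5 : ∑ j ∈ Finset.range (k + 1), ((2 * k + 1).choose (2 * (j + 1) - 1) : ℂ) *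
      χ ^ (2 * (k + 1 - (j + 1))) * (χ ^ 2 - 4) ^ (j + 1 - 1) =
      ∑ j ∈ Finset.range (k + 1),
        ((2 * k + 1).choose (2 * j + 1) : ℂ) * χ ^ (2 * (k - j)) * (s ^ 2) ^ j := by
    refine Finset.sum_congr rfl fun j _ => ?_
    rw [hs, Nat.add_sub_add_right, Nat.add_sub_cancel, show 2 * (j + 1) - 1 = 2 * j + 1 by omega]
  rw [e5]
  have h4 : (2 : ℂ) ^ (2 * k + 1) = 2 * 4 ^ k := by
    rw [pow_succ, pow_mul]
    norm_num
    ring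
  refine mul_left_cancel₀ (mul_ne_zero two_ne_zero hs0) ?_
  rw [← e4]
  rw [h4] at e1
  have h40 : (4 : ℂ) ^ k ≠ 0 := pow_ne_zero _ (by norm_num)
  field_simp at e1
  linear_combination e1

/-! ### Existence and uniqueness of the multiplicities -/

theorem continuous_chebyshevAt (l : ℕ) : Continuous fun χ => chebyshevAt χ l :=
  (Polynomial.Chebyshev.S ℂ l).continuous

theorem continuous_trace_actMatrix {m : ℕ} (k : ℕ) (a : Diagram m) :
    Continuous fun χ => (actMatrix χ k a).trace := by
  classical
  refine continuous_finsetSum _ fun w _ => ?_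
  simp only [Matrix.diag_apply, actMatrix, Matrix.of_apply]
  split_ifs
  · fun_prop
  · fun_prop

/-- The trace identity for diagrams. For `χ = 0` it follows by continuity, as both sides are
polynomials in the loop value. -/
theorem pow_closeLoops_eq (χ : ℂ) (n : ℕ) (a : Diagram (2 * n)) :
    χ ^ closeLoops a =
      ∑ k ∈ Finset.range (n + 1), chebyshevAt χ (2 * k) * (actMatrix χ k a).trace := by
  have h := Continuous.ext_on (dense_compl_singleton (0 : ℂ))
    (f := fun χ : ℂ => χ ^ closeLoops a)
    (g := fun χ => ∑ k ∈ Finset.range (n + 1), chebyshevAt χ (2 * k) * (actMatrix χ k a).trace)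
    (by fun_prop)
    (continuous_finsetSum _ fun k _ =>
      (continuous_chebyshevAt _).mul (continuous_trace_actMatrix k a))
    (fun χ hχ => pow_closeLoops_eq_sum hχ
      (sum_card_linkState (chebyshevAt_zero χ) (chebyshevAt_one χ) (chebyshevAt_add_two χ)) n a)
  exact congrFun h χ

theorem isMultiplicity_iff (χ : ℂ) (n : ℕ) (d : ℕ → ℂ) :
    IsMultiplicity χ (2 * n) (fun k => d k) ↔ ∀ a : Diagram (2 * n),
      χ ^ closeLoops a = ∑ k ∈ Finset.range (n + 1), d k * (actMatrix χ k a).trace := by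
  have hn : 2 * n / 2 + 1 = n + 1 := by omega
  have hsum : ∀ t, ∑ k : Fin (2 * n / 2 + 1), d k * (stdRep χ (2 * n) k t).trace =
      ∑ k ∈ Finset.range (n + 1), d k * (stdRep χ (2 * n) k t).trace := fun t => by
    rw [Fin.sum_univ_eq_sum_range (fun k => d k * (stdRep χ (2 * n) k t).trace), hn]
  have hsingle : ∀ k (a : Diagram (2 * n)),
      stdRep χ (2 * n) k (Finsupp.single a 1) = actMatrix χ k a := fun k a => by
    rw [stdRep, Finsupp.linearCombination_single, one_smul]
  simp only [IsMultiplicity, hsum]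
  constructor
  · intro h a
    have := h (Finsupp.single a 1)
    simpa only [hsingle, trTL, Finsupp.linearCombination_single, one_smul] using this
  · intro h t
    have hlin : trTL χ (2 * n) = ∑ k ∈ Finset.range (n + 1),
        d k • (Matrix.traceLinearMap _ ℂ ℂ ∘ₗ stdRep χ (2 * n) k) := by
      refine Finsupp.lhom_ext' fun a => LinearMap.ext_ring ?_
      simp only [LinearMap.comp_apply, Finsupp.lsingle_apply, LinearMap.sum_apply,
        LinearMap.smul_apply, hsingle, Matrix.traceLinearMap_apply, smul_eq_mul, ← h a]
      rw [trTL, Finsupp.linearCombination_single, one_smul]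
    rw [hlin]
    simp

theorem nonempty_linkState (n : ℕ) : Nonempty (LinkState (2 * n) n) :=
  ⟨⟨id, fun _ => rfl, fun i j h => by simp only [id] at h; omega,
    fun i j _ h => by simp only [id] at h; omega, by simp⟩⟩

/-- Uniqueness of the multiplicities for `χ ≠ 0`. Inserting arcs into the diagrams with two points
less determines all multiplicities but the last, whose module is not annihilated by the unit. -/
theorem multiplicity_unique {χ : ℂ} (hχ : χ ≠ 0) {c d : ℕ → ℂ} (n : ℕ)
    (hc : ∀ a : Diagram (2 * n),
      χ ^ closeLoops a = ∑ k ∈ Finset.range (n + 1), c k * (actMatrix χ k a).trace)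
    (hd : ∀ a : Diagram (2 * n),
      χ ^ closeLoops a = ∑ k ∈ Finset.range (n + 1), d k * (actMatrix χ k a).trace) :
    ∀ k ≤ n, c k = d k := by
  have top : ∀ n, (∀ a : Diagram (2 * n),
      χ ^ closeLoops a = ∑ k ∈ Finset.range (n + 1), c k * (actMatrix χ k a).trace) →
      (∀ a : Diagram (2 * n),
      χ ^ closeLoops a = ∑ k ∈ Finset.range (n + 1), d k * (actMatrix χ k a).trace) →
      (∀ k < n, c k = d k) → ∀ k ≤ n, c k = d k := by
    intro n hc hd hlt k hk
    rcases hk.lt_or_eq with h | rfl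
    · exact hlt k h
    have h := (hc (Diagram.one _)).symm.trans (hd (Diagram.one _))
    rw [Finset.sum_range_succ, Finset.sum_range_succ, Finset.sum_congr rfl fun i hi => by
      rw [hlt i (Finset.mem_range.1 hi)], add_right_inj, trace_actMatrix_one] at h
    have := nonempty_linkState k
    exact mul_right_cancel₀ (Nat.cast_ne_zero.2 Nat.card_pos.ne') h
  induction n with
  | zero => exact top 0 hc hd (fun k hk => absurd hk (Nat.not_lt_zero k))
  | succ n ih =>
    have step : ∀ e : ℕ → ℂ, (∀ a : Diagram (2 * (n + 1)),
        χ ^ closeLoops a = ∑ k ∈ Finset.range (n + 2), e k * (actMatrix χ k a).trace) →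
        ∀ b : Diagram (2 * n),
          χ ^ closeLoops b = ∑ k ∈ Finset.range (n + 1), e k * (actMatrix χ k b).trace := by
      intro e he b
      obtain ⟨a, H⟩ := exists_insertion 0 (Nat.zero_le (2 * n)) b
      have h := he a
      rw [H.sum_trace_actMatrix, H.closeLoops_eq, pow_succ'] at h
      exact mul_left_cancel₀ hχ h
    exact top (n + 1) hc hd fun k hk => ih (step c hc) (step d hd) k (Nat.lt_succ_iff.1 hk)

end TemperleyLieb

theorem mainTheorem1 :
    ∃ P : ℕ → Polynomial ℤ,
      (P 0 = 1 ∧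
        P 1 = Polynomial.X ^ 2 - 1 ∧
        P 2 = Polynomial.X ^ 4 - 3 * Polynomial.X ^ 2 + 1 ∧
        P 3 = Polynomial.X ^ 6 - 5 * Polynomial.X ^ 4 + 6 * Polynomial.X ^ 2 - 1) ∧
      (∀ k : ℕ, 4 ^ k * P k =
        ∑ n ∈ Finset.Icc 1 (k + 1),
          ((Nat.choose (2 * k + 1) (2 * n - 1) : ℕ) : Polynomial ℤ) *
            Polynomial.X ^ (2 * (k + 1 - n)) * (Polynomial.X ^ 2 - 4) ^ (n - 1)) ∧
      ∀ χ : ℂ, ∃ d : ℕ → ℂ,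
        (∀ m : ℕ, Even m → TemperleyLieb.IsMultiplicity χ m (fun k => d k)) ∧
        (χ ≠ 0 → ∀ m : ℕ, Even m → ∀ c : Fin (m / 2 + 1) → ℂ,
          TemperleyLieb.IsMultiplicity χ m c → ∀ k : Fin (m / 2 + 1), c k = d k) ∧
        (∀ q : ℂ, q ≠ 0 → χ = q + q⁻¹ → ∀ k : ℕ,
          d k = TemperleyLieb.qNumber q (2 * k + 1) ∧
          (q ≠ q⁻¹ →
            d k = (q ^ (2 * k + 1) - q⁻¹ ^ (2 * k + 1)) / (q - q⁻¹))) ∧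
        (∀ k : ℕ, d k = Polynomial.aeval χ (P k)) := by
  refine ⟨TemperleyLieb.multPoly, TemperleyLieb.multPoly_values,
    TemperleyLieb.four_pow_mul_multPoly, fun χ =>
    ⟨fun k => TemperleyLieb.chebyshevAt χ (2 * k), ?_, ?_, ?_, fun k =>
      (TemperleyLieb.aeval_multPoly χ k).symm⟩⟩
  · intro m hm
    obtain ⟨n, rfl⟩ := hm.exists_two_nsmul
    rw [smul_eq_mul]
    exact (TemperleyLieb.isMultiplicity_iff χ n _).2 (TemperleyLieb.pow_closeLoops_eq χ n)
  · intro hχ m hm c hc k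
    obtain ⟨n, rfl⟩ := even_iff_two_dvd.1 hm
    set c' : ℕ → ℂ := fun k => if h : k < 2 * n / 2 + 1 then c ⟨k, h⟩ else 0
    have hcc : c = fun k : Fin (2 * n / 2 + 1) => c' k := by
      funext k
      simp only [c', dif_pos k.2]
    rw [hcc] at hc ⊢
    exact TemperleyLieb.multiplicity_unique hχ n ((TemperleyLieb.isMultiplicity_iff χ n _).1 hc)
      (TemperleyLieb.pow_closeLoops_eq χ n) k (by have := k.2; omega)
  · rintro q hq rfl k
    refine ⟨(TemperleyLieb.qNumber_eq_chebyshevAt hq (2 * k)).symm, fun hne => ?_⟩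
    rw [eq_div_iff (sub_ne_zero.2 hne), TemperleyLieb.chebyshevAt_mul_sub hq]
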